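/- \textbf{Setting.} Consider $\min_{w\in\mathbb R^p}\max_{u\in\mathbb R^q}\{f(w)+\mathcal H(w,u)-h(u)\}$ with $\mathcal H=\frac1n\sum_{i=1}^n\mathcal H_i$, $n\ge 1$, $\mathcal H_i:\mathbb R^p\times\mathbb R^q\to\mathbb R$ differentiable, and $f,h$ proper, closed, convex with values in $\mathbb R\cup\{+\infty\}$. Let $\Phi_0(w)=\max_u\{\mathcal H(w,u)-h(u)\}$, $u_0^*(w)=\arg\max_u\{\mathcal H(w,u)-h(u)\}$, $\Psi_0=\Phi_0+f$, $\Psi_0^\star=\inf\Psi_0$, and $\mathcal G_\eta(w)=\eta^{-1}\big(w-\mathrm{prox}_{\eta f}(w-\eta\nabla\Phi_0(w))\big)$. \textbf{Assumptions.} $\Psi_0^\star>-\infty$; $h$ is $\mu_h$-strongly convex and $\mathrm{dom}(h)$ is bounded; each $\mathcal H_i(w,\cdot)$ is $\mu_H$-strongly concave, where $\mu_h,\mu_H\ge0$ and $\mu_h+\mu_H>0$; for some $L_w,L_u>0$ and all $i$, $\|\nabla\mathcal H_i(w,u)-\nabla\mathcal H_i(w',u')\|^2\le L_w^2\|w-w'\|^2+L_u^2\|u-u'\|^2$;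 for some $\Theta_w,\sigma_w,\Theta_u,\sigma_u\ge0$, $\frac1n\sum_i\|\nabla_w\mathcal H_i-\nabla_w\mathcal H\|^2\le\Theta_w\|\nabla_w\mathcal H\|^2+\sigma_w^2$ and $\frac1n\sum_i\|\nabla_u\mathcal H_i-\nabla_u\mathcal H\|^2\le\Theta_u\|\nabla_u\mathcal H\|^2+\sigma_u^2$ everywhere. There are $\Lambda_0\ge1$, $\Lambda_1\ge0$ with $\|\nabla\Phi_0(w)\|^2\le\Lambda_0\|\mathcal G_\eta(w)\|^2+\Lambda_1$ for all $w\in\mathrm{dom}(\Phi_0)$, where $\eta$ is the step size used below (the constants do not depend on $\eta$). \textbf{Constants.} $\kappa=\frac{L_u}{\mu_H+\mu_h}$, $L_{\Phi_0}=(1+\kappa)L_w$, $C_0=2\Lambda_0L_w^2(3\Theta_w+1)$, $C_w=L_w^2(3\Theta_w+1)\Lambda_1+3L_w^2\sigma_w^2$, $B_0=\hat\eta\big(\mu_h+\frac{\mu_HL_u}{L_u+\mu_H}\big)$, $M_\omega(\eta)=\frac1\omega+\big(\omega L_u^2\kappa^2+\frac{2L_w^2}{\omega}\big)\eta^2$.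 \textbf{Algorithm.} Start from $\tilde w_0\in\mathrm{dom}(f)$, $\tilde u_0\in\mathrm{dom}(h)$. In epoch $t\ge1$, starting from $u=\tilde u_{t-1}$, perform $S$ times $u\leftarrow\mathrm{prox}_{\hat\eta h}\big(u+\frac{\hat\eta}{n}\sum_i\nabla_u\mathcal H_i(\tilde w_{t-1},u)\big)$ to get $\tilde u_t$; then, for an arbitrary permutation $\pi_t$ of $\{1,\dots,n\}$ and $w_0=\tilde w_{t-1}$, set $w_i=w_{i-1}-\frac{\eta}{n}\nabla_w\mathcal H_{\pi_t(i)}(w_{i-1},\tilde u_t)$ for $i=1,\dots,n$, and $\tilde w_t=\mathrm{prox}_{\eta f}(w_n)$. \textbf{Theorem.} Let $0<\hat\eta\le\frac{2}{L_u+\mu_H}$. The maximizer $u_0^*(w)$ exists and is unique for every $w$, and $\Phi_0$ is finite and differentiable. (a) Let $\omega>0$, $S=\big\lceil\frac{M_\omega(\eta)}{2B_0}\big\rceil$ and $$0<\eta\le\min\Big\{\frac1{2\sqrt{C_0}},\ \frac1{4L_{\Phi_0}},\ \frac1{2\omega L_u\kappa}\Big\}.\qquad(1)$$ Then for all $T\ge0$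 $$\frac1{T+1}\sum_{t=0}^T\|\mathcal G_\eta(\tilde w_t)\|^2\le\frac{4\big[2(\Psi_0(\tilde w_0)-\Psi_0^\star)+\omega L_u^2\eta\|\tilde u_0-u_0^*(\tilde w_0)\|^2\big]}{\eta(T+1)}+8C_w\eta^2 .$$ (b) $B_0>0$. If $\omega=1/B_0$ and $0<\eta\le\min\big\{\frac1{2\sqrt{C_0}},\frac1{4L_{\Phi_0}},\frac{B_0}{\sqrt{L_u^2\kappa^2+2B_0^2L_w^2}}\big\}$, then $S=1$. This bound on $\eta$ is implied by (1) with $\omega=1/B_0$; so for all such $\eta$ the estimate in (a) holds with a single ascent step per epoch. (c) Fix $\omega>0$, $s\in(0,1)$ and $C>0$ with $C\ge C_w$ (e.g. $C=C_w$ if $C_w>0$). For $\epsilon>0$ let $\eta=\frac{s\epsilon}{4\sqrt C}$, let $S$ be as in (a), and let $$\bar T=\frac{32\sqrt C\,(\Psi_0(\tilde w_0)-\Psi_0^\star)}{s(1-s^2)\epsilon^3}+\frac{4\omega L_u^2\|\tilde u_0-u_0^*(\tilde w_0)\|^2}{(1-s^2)\epsilon^2}.$$ Condition (1) holds for all sufficiently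 small $\epsilon$. Whenever it holds, for every $T\ge\lfloor\bar T\rfloor$ one has $\frac1{T+1}\sum_{t=0}^T\|\mathcal G_\eta(\tilde w_t)\|^2\le\epsilon^2$; consequently $\|\mathcal G_\eta(\hat w_T)\|^2\le\epsilon^2$ if $\hat w_T$ is an iterate $\tilde w_t$, $0\le t\le T$, with smallest $\|\mathcal G_\eta(\tilde w_t)\|$, and $\mathbb E\|\mathcal G_\eta(\hat w_T)\|^2\le\epsilon^2$ if $\hat w_T$ is drawn uniformly from $\tilde w_0,\dots,\tilde w_T$. Moreover $S=\mathcal O(1)$, and for $T=\lfloor\bar T\rfloor=\mathcal O(\epsilon^{-3})$ the $T$ epochs use $\mathcal O(n\epsilon^{-3})$ evaluations of $\nabla_w\mathcal H_i$ and of $\nabla_u\mathcal H_i$, and $\mathcal O(\epsilon^{-3})$ evaluations of $\mathrm{prox}_{\eta f}$ and of $\mathrm{prox}_{\hat\eta h}$. The constants in $\mathcal O(\cdot)$ depend only on the constants in the assumptions, on $\hat\eta,\omega,s,C$, and on upper bounds for $\Psi_0(\tilde w_0)-\Psi_0^\star$ and $\|\tilde u_0-u_0^*(\tilde w_0)\|^2$;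 they depend neither on $n$ nor on $\epsilon$. -/

import Mathlib

noncomputable section

namespace ShufflingMinimax

/-- The Euclidean space `ℝ^d`. -/
abbrev Euc (d : ℕ) : Type := EuclideanSpace ℝ (Fin d)

/-- Effective domain of an extended-real-valued function. -/
def effDom {d : ℕ} (φ : Euc d → EReal) : Set (Euc d) := {x | φ x < ⊤}

/-- Proper, closed (lower semicontinuous) and convex functions `ℝ^d → ℝ ∪ {+∞}`. -/
structure IsProperClosedConvex {d : ℕ} (φ : Euc d → EReal) : Prop where
  ne_bot : ∀ x, φ x ≠ ⊥
  nonempty : (effDom φ).Nonempty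
  closed : LowerSemicontinuous φ
  convex : ConvexOn ℝ (effDom φ) (fun x => (φ x).toReal)

/-- A global minimizer of `φ` (an arbitrary point if there is none). -/
def argminPt {d : ℕ} (φ : Euc d → EReal) : Euc d :=
  Classical.epsilon fun y => ∀ z, φ y ≤ φ z

/-- `prox_{ηφ}(x) = argmin_y { φ(y) + ‖y - x‖² / (2η) }`, for `η > 0`. -/
def prox {d : ℕ} (η : ℝ) (φ : Euc d → EReal) (x : Euc d) : Euc d :=
  argminPt fun y => φ y + ((‖y - x‖ ^ 2 / (2 * η) : ℝ) : EReal)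

/-- The data of `min_w max_u { f(w) + (1/n) ∑ᵢ Hᵢ(w,u) - h(u) }`. -/
structure Problem (n p q : ℕ) where
  H : Fin n → Euc p → Euc q → ℝ
  f : Euc p → EReal
  h : Euc q → EReal

namespace Problem

variable {n p q : ℕ} (P : Problem n p q)

/-- `H(w,u) = (1/n) ∑ᵢ Hᵢ(w,u)`. -/
def Hbar (w : Euc p) (u : Euc q) : ℝ := (1 / (n : ℝ)) * ∑ i, P.H i w u

/-- Partial gradient `∇_w Hᵢ(w,u)`. -/
def gradW (i : Fin n) (w : Euc p) (u : Euc q) : Euc p := gradient (fun w' => P.H i w' u) w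

/-- Partial gradient `∇_u Hᵢ(w,u)`. -/
def gradU (i : Fin n) (w : Euc p) (u : Euc q) : Euc q := gradient (fun u' => P.H i w u') u

/-- `∇_w H(w,u)`. -/
def gradWbar (w : Euc p) (u : Euc q) : Euc p := gradient (fun w' => P.Hbar w' u) w

/-- `∇_u H(w,u)`. -/
def gradUbar (w : Euc p) (u : Euc q) : Euc q := gradient (fun u' => P.Hbar w u') u

/-- `Φ₀(w) = sup_u { H(w,u) - h(u) }`. -/
def Phi (w : Euc p) : EReal := ⨆ u, ((P.Hbar w u : ℝ) : EReal) - P.h u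

/-- `u₀*(w) = argmax_u { H(w,u) - h(u) } = argmin_u { h(u) - H(w,u) }`. -/
def uStar (w : Euc p) : Euc q := argminPt fun u => P.h u - ((P.Hbar w u : ℝ) : EReal)

/-- `Ψ₀ = Φ₀ + f`. -/
def Psi (w : Euc p) : EReal := P.Phi w + P.f w

/-- `Ψ₀* = inf_w Ψ₀(w)`. -/
def PsiStar : EReal := ⨅ w, P.Psi w

/-- `∇Φ₀(w)`. -/
def gradPhi (w : Euc p) : Euc p := gradient (fun w' => (P.Phi w').toReal) w

/-- The gradient mapping `𝒢_η(w) = η⁻¹ (w - prox_{ηf}(w - η ∇Φ₀(w)))`. -/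
def gradMap (η : ℝ) (w : Euc p) : Euc p := η⁻¹ • (w - prox η P.f (w - η • P.gradPhi w))

end Problem

/-- The constants that occur in the assumptions. -/
structure Consts where
  Lw : ℝ
  Lu : ℝ
  muH : ℝ
  muh : ℝ
  Mh : ℝ
  Thw : ℝ
  sigw : ℝ
  Thu : ℝ
  sigu : ℝ
  Lam0 : ℝ
  Lam1 : ℝ

namespace Consts

/-- Admissible ranges of the constants; `μ_H + μ_h > 0` is the strong concavity of the lower
level problem. -/
structure Valid (c : Consts) : Prop where
  Lw_pos : 0 < c.Lw
  Lu_pos : 0 < c.Lu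
  muH_nonneg : 0 ≤ c.muH
  muh_nonneg : 0 ≤ c.muh
  mu_pos : 0 < c.muH + c.muh
  Thw_nonneg : 0 ≤ c.Thw
  sigw_nonneg : 0 ≤ c.sigw
  Thu_nonneg : 0 ≤ c.Thu
  sigu_nonneg : 0 ≤ c.sigu
  Lam0_ge : 1 ≤ c.Lam0
  Lam1_nonneg : 0 ≤ c.Lam1

variable (c : Consts)

/-- `κ = L_u / (μ_H + μ_h)`. -/
def kappa : ℝ := c.Lu / (c.muH + c.muh)

/-- `L_{Φ₀} = (1 + κ) L_w`. -/
def LPhi : ℝ := (1 + c.kappa) * c.Lw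

/-- `C₀ = 2 Λ₀ L_w² (3 Θ_w + 1)`. -/
def C0 : ℝ := 2 * c.Lam0 * c.Lw ^ 2 * (3 * c.Thw + 1)

/-- `C_w = L_w² (3 Θ_w + 1) Λ₁ + 3 L_w² σ_w²`. -/
def Cw : ℝ := c.Lw ^ 2 * (3 * c.Thw + 1) * c.Lam1 + 3 * c.Lw ^ 2 * c.sigw ^ 2

/-- `M_ω(η) = 1/ω + (ω L_u² κ² + 2 L_w² / ω) η²`. -/
def Mom (ω η : ℝ) : ℝ :=
  1 / ω + (ω * c.Lu ^ 2 * c.kappa ^ 2 + 2 * c.Lw ^ 2 / ω) * η ^ 2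

/-- `B₀ = η̂ (μ_h + μ_H L_u / (L_u + μ_H))`. -/
def B0 (ηh : ℝ) : ℝ := ηh * (c.muh + c.muH * c.Lu / (c.Lu + c.muH))

/-- The number of ascent steps per epoch, `S = ⌈M_ω(η) / (2 B₀)⌉`. -/
def numSteps (ω η ηh : ℝ) : ℕ := ⌈c.Mom ω η / (2 * c.B0 ηh)⌉₊

/-- `0 < η ≤ min { 1/(2√C₀), 1/(4 L_{Φ₀}), 1/(2 ω L_u κ) }`. -/
def StepSize (ω η : ℝ) : Prop :=
  0 < η ∧ η ≤ min (min (1 / (2 * Real.sqrt c.C0)) (1 / (4 * c.LPhi)))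
    (1 / (2 * ω * c.Lu * c.kappa))

/-- `0 < η ≤ min { 1/(2√C₀), 1/(4 L_{Φ₀}), B₀ / √(L_u² κ² + 2 B₀² L_w²) }`. -/
def OneStepSize (ηh η : ℝ) : Prop :=
  0 < η ∧ η ≤ min (min (1 / (2 * Real.sqrt c.C0)) (1 / (4 * c.LPhi)))
    (c.B0 ηh / Real.sqrt (c.Lu ^ 2 * c.kappa ^ 2 + 2 * c.B0 ηh ^ 2 * c.Lw ^ 2))

end Consts

/-- The standing assumptions on the problem in the nonconvex-strongly concave setting. -/
structure Assumptions {n p q : ℕ} (P : Problem n p q) (c : Consts) : Prop where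
  /-- `Ψ₀* > -∞` -/
  bddBelow : ⊥ < P.PsiStar
  /-- every `Hᵢ` is (jointly) differentiable -/
  diff : ∀ i, Differentiable ℝ (fun z : Euc p × Euc q => P.H i z.1 z.2)
  f_pcc : IsProperClosedConvex P.f
  h_pcc : IsProperClosedConvex P.h
  /-- `h` is `μ_h`-strongly convex -/
  h_strong : StrongConvexOn (effDom P.h) c.muh (fun u => (P.h u).toReal)
  /-- `dom h` is bounded by `M_h` -/
  h_bdd : ∀ u ∈ effDom P.h, ‖u‖ ≤ c.Mh
  /-- `Hᵢ(w,·)` is `μ_H`-strongly concave (concave if `μ_H = 0`) -/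
  H_strong : ∀ i w, StrongConcaveOn Set.univ c.muH (fun u => P.H i w u)
  /-- `‖∇Hᵢ(w,u) - ∇Hᵢ(w',u')‖² ≤ L_w² ‖w - w'‖² + L_u² ‖u - u'‖²` -/
  H_lip : ∀ i w u w' u',
    ‖P.gradW i w u - P.gradW i w' u'‖ ^ 2 + ‖P.gradU i w u - P.gradU i w' u'‖ ^ 2
      ≤ c.Lw ^ 2 * ‖w - w'‖ ^ 2 + c.Lu ^ 2 * ‖u - u'‖ ^ 2
  varW : ∀ w u, (1 / (n : ℝ)) * ∑ i, ‖P.gradW i w u - P.gradWbar w u‖ ^ 2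
    ≤ c.Thw * ‖P.gradWbar w u‖ ^ 2 + c.sigw ^ 2
  varU : ∀ w u, (1 / (n : ℝ)) * ∑ i, ‖P.gradU i w u - P.gradUbar w u‖ ^ 2
    ≤ c.Thu * ‖P.gradUbar w u‖ ^ 2 + c.sigu ^ 2

/-- `‖∇Φ₀(w)‖² ≤ Λ₀ ‖𝒢_η(w)‖² + Λ₁` for all `w ∈ dom Φ₀`. -/
def GradMapBound {n p q : ℕ} (P : Problem n p q) (c : Consts) (η : ℝ) : Prop :=
  ∀ w ∈ effDom P.Phi, ‖P.gradPhi w‖ ^ 2 ≤ c.Lam0 * ‖P.gradMap η w‖ ^ 2 + c.Lam1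

/-- State of the algorithm: the current iterates, and the numbers of evaluations of `∇_w Hᵢ`,
`∇_u Hᵢ`, `prox_{ηf}` and `prox_{η̂h}` made so far. -/
structure State (p q : ℕ) where
  w : Euc p
  u : Euc q
  evalW : ℕ
  evalU : ℕ
  evalProxF : ℕ
  evalProxH : ℕ

namespace Problem

variable {n p q : ℕ} (P : Problem n p q)

/-- One proximal gradient ascent step
`u ← prox_{η̂h}(u + (η̂/n) ∑ᵢ ∇_u Hᵢ(w,u))`; the sum is accumulated term by term. -/
def ascentStep (ηh : ℝ) (s : State p q) : State p q :=
  let a := (List.finRange n).foldl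
    (fun (a : Euc q × ℕ) i => (a.1 + P.gradU i s.w s.u, a.2 + 1)) (0, s.evalU)
  { s with
    u := prox ηh P.h (s.u + (ηh / (n : ℝ)) • a.1)
    evalU := a.2
    evalProxH := s.evalProxH + 1 }

/-- One shuffling step `w ← w - (η/n) ∇_w H_{σ(i)}(w,u)`. -/
def descentStep (η : ℝ) (σ : Equiv.Perm (Fin n)) (s : State p q) (i : Fin n) : State p q :=
  { s with
    w := s.w - (η / (n : ℝ)) • P.gradW (σ i) s.w s.u
    evalW := s.evalW + 1 }

/-- One epoch: `S` ascent steps in `u`, then the `n` shuffling steps in `w` in the order given by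
the permutation `σ`, then `w ← prox_{ηf}(w)`. -/
def epoch (η ηh : ℝ) (S : ℕ) (σ : Equiv.Perm (Fin n)) (s : State p q) : State p q :=
  let s₁ := (P.ascentStep ηh)^[S] s
  let s₂ := (List.finRange n).foldl (P.descentStep η σ) s₁
  { s₂ with
    w := prox η P.f s₂.w
    evalProxF := s₂.evalProxF + 1 }

/-- The semi-shuffling variant of the alternating shuffling proximal gradient algorithm: the state
`(w̃_t, ũ_t)` after `t` epochs. Epoch `t + 1` uses the permutation `π t`. -/
def run (η ηh : ℝ) (S : ℕ) (π : ℕ → Equiv.Perm (Fin n)) (w₀ : Euc p) (u₀ : Euc q) :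
    ℕ → State p q
  | 0 => ⟨w₀, u₀, 0, 0, 0, 0⟩
  | t + 1 => P.epoch η ηh S (π t) (run η ηh S π w₀ u₀ t)

/-- `Ψ₀(w₀) - Ψ₀*`. -/
def gap (w₀ : Euc p) : ℝ := (P.Psi w₀).toReal - P.PsiStar.toReal

/-- `(1/(T+1)) ∑_{t=0}^{T} ‖𝒢_η(x_t)‖²`. -/
def avgGradMap (η : ℝ) (x : ℕ → Euc p) (T : ℕ) : ℝ :=
  (1 / ((T : ℝ) + 1)) * ∑ t ∈ Finset.range (T + 1), ‖P.gradMap η (x t)‖ ^ 2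

end Problem

/-- `T̄ = 32 √C (Ψ₀(w̃₀) - Ψ₀*) / (s (1-s²) ε³) + 4 ω L_u² ‖ũ₀ - u₀*(w̃₀)‖² / ((1-s²) ε²)`. -/
def Tbar {n p q : ℕ} (P : Problem n p q) (c : Consts) (ω s C ε : ℝ) (w₀ : Euc p) (u₀ : Euc q) :
    ℝ :=
  32 * Real.sqrt C * P.gap w₀ / (s * (1 - s ^ 2) * ε ^ 3)
    + 4 * ω * c.Lu ^ 2 * ‖u₀ - P.uStar w₀‖ ^ 2 / ((1 - s ^ 2) * ε ^ 2)

end ShufflingMinimax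

end

noncomputable section

namespace ShufflingMinimax

open Filter Topology Set

/-! ### First-order inequalities for smooth and strongly convex functions. -/

section Smooth

variable {E : Type*} [NormedAddCommGroup E] [InnerProductSpace ℝ E] [CompleteSpace E]

/-! The epoch map decreases the Lyapunov function `Ψ₀(w) + (ω L_u² η / 2) ‖u - u₀*(w)‖²` up to an
error of order `η³`. With `u₀*` Lipschitz (`uStar_lip`), `Φ₀` has gradient `∇_w H(w, u₀*(w))`
(`hasGradientAt_Phi`), which is Lipschitz as well, so one epoch is an inexact proximal gradient step
on `Ψ₀`.

Three estimates feed the descent. Each ascent step shrinks the distance to `u₀*(w)` by `1/(1 + B₀)`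
(`prox_ascent_contraction`), so `S` steps shrink it by at least `1 + S B₀ ≥ 1 + M_ω/2`. The `n`
shuffled steps amount to `w - η g`, and `g` differs from `∇Φ₀(w)` by the tracking error in `u` plus
the drift of the inner loop (`shuffling_error`): over a full permutation the deviations of the
component gradients from their mean cancel, whence the squared error from the variance is `O(η²)`
for every order. Finally `inexact_prox_descent` compares the inexact step with the exact one.

Moving `w` also moves `u₀*`, which produces a cross term between the tracking error and the step
length; `lyapunov_scalar` shows that `M_ω` and the step size bounds absorb it. The growth bound on
`∇Φ₀` turns the drift into a quarter of `‖𝒢_η‖²` plus a constant (`epoch_descent`). Telescoping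
gives (a). Parts (b) and (c) are arithmetic with `M_ω`, `η` and `T̄`, together with the evaluation
counts carried in the state. -/

theorem hasDerivAt_line {g : E → ℝ} {p x v : E} {t : ℝ} (h : HasGradientAt g p (x + t • v)) :
    HasDerivAt (fun s : ℝ => g (x + s • v)) (inner ℝ p v) t := by
  have h1 : HasDerivAt (fun s : ℝ => x + s • v) v t := by
    simpa using ((hasDerivAt_id t).smul_const v).const_add x
  have h2 := h.hasFDerivAt.comp_hasDerivAt t h1
  rw [InnerProductSpace.toDual_apply_apply] at h2
  exact h2

/-- If `ψ(x + t v) ≤ ψ(x) + t (A + t B)` for small `t > 0`, then `⟪∇ψ(x), v⟫ ≤ A`. -/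
theorem inner_gradient_le_of_le {ψ : E → ℝ} {p x v : E} (h : HasGradientAt ψ p x) {A B : ℝ}
    (hle : ∀ t : ℝ, 0 < t → t < 1 → ψ (x + t • v) ≤ ψ x + t * (A + t * B)) :
    inner ℝ p v ≤ A := by
  have h0 : HasDerivAt (fun s : ℝ => ψ (x + s • v)) (inner ℝ p v) 0 :=
    hasDerivAt_line (by simpa using h)
  have h1 := h0.hasDerivWithinAt (s := Ioi 0)
  rw [hasDerivWithinAt_iff_tendsto_slope' (by simp)] at h1
  have h2 : Tendsto (fun t : ℝ => A + t * B) (𝓝[>] 0) (𝓝 A) := by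
    have : Tendsto (fun t : ℝ => A + t * B) (𝓝 0) (𝓝 (A + 0 * B)) := by
      apply Continuous.tendsto; fun_prop
    simp only [zero_mul, add_zero] at this
    exact this.mono_left nhdsWithin_le_nhds
  refine le_of_tendsto_of_tendsto h1 h2 ?_
  filter_upwards [Ioo_mem_nhdsGT (zero_lt_one' ℝ)] with t ht
  have := hle t ht.1 ht.2
  rw [slope_def_field]
  simp only [zero_smul, add_zero, sub_zero]
  rw [div_le_iff₀ ht.1]
  linarith

/-- The quadratic upper bound of a function with one-sided Lipschitz gradient. -/
theorem le_quadratic_of_gradient {g : E → ℝ} {G : E → E} (hg : ∀ x, HasGradientAt g (G x) x)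
    {L : ℝ} (hL : ∀ x y, inner ℝ (G y - G x) (y - x) ≤ L * ‖y - x‖ ^ 2) (x y : E) :
    g y ≤ g x + inner ℝ (G x) (y - x) + L / 2 * ‖y - x‖ ^ 2 := by
  set v := y - x with hv
  have hd : ∀ t : ℝ, HasDerivAt
      (fun t : ℝ => g (x + t • v) - t * inner ℝ (G x) v - t ^ 2 * (L / 2 * ‖v‖ ^ 2))
      (inner ℝ (G (x + t • v)) v - inner ℝ (G x) v - 2 * t * (L / 2 * ‖v‖ ^ 2)) t := by
    intro t
    have h1 := hasDerivAt_line (hg (x + t • v))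
    have h2 : HasDerivAt (fun t : ℝ => t * inner ℝ (G x) v) (inner ℝ (G x) v) t := by
      simpa using (hasDerivAt_id t).mul_const (inner ℝ (G x) v)
    have h3 : HasDerivAt (fun t : ℝ => t ^ 2 * (L / 2 * ‖v‖ ^ 2)) (2 * t * (L / 2 * ‖v‖ ^ 2)) t := by
      simpa using (hasDerivAt_pow 2 t).mul_const (L / 2 * ‖v‖ ^ 2)
    exact (h1.sub h2).sub h3
  have hanti : AntitoneOn
      (fun t : ℝ => g (x + t • v) - t * inner ℝ (G x) v - t ^ 2 * (L / 2 * ‖v‖ ^ 2))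
      (Icc 0 1) := by
    apply antitoneOn_of_deriv_nonpos (convex_Icc 0 1)
    · exact fun t _ => (hd t).continuousAt.continuousWithinAt
    · exact fun t _ => (hd t).differentiableAt.differentiableWithinAt
    · intro t ht
      rw [interior_Icc] at ht
      rw [(hd t).deriv]
      have h1 := hL x (x + t • v)
      simp only [add_sub_cancel_left, inner_smul_right, norm_smul, inner_sub_left,
        Real.norm_eq_abs, mul_pow, sq_abs] at h1
      have ht0 : 0 < t := ht.1
      have : t * (inner ℝ (G (x + t • v)) v - inner ℝ (G x) v - 2 * t * (L / 2 * ‖v‖ ^ 2)) ≤ 0 := by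
        nlinarith
      by_contra hcon
      push Not at hcon
      nlinarith [mul_pos ht0 hcon]
  have h := hanti (left_mem_Icc.2 zero_le_one) (right_mem_Icc.2 zero_le_one) zero_le_one
  simp only [one_smul, zero_smul, add_zero] at h
  have hxy : x + v = y := by rw [hv]; abel
  rw [hxy] at h
  linarith

theorem le_quadratic_of_lipschitz_gradient {g : E → ℝ} {G : E → E}
    (hg : ∀ x, HasGradientAt g (G x) x) {L : ℝ} (hL : ∀ x y, ‖G y - G x‖ ≤ L * ‖y - x‖) (x y : E) :
    g y ≤ g x + inner ℝ (G x) (y - x) + L / 2 * ‖y - x‖ ^ 2 := by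
  refine le_quadratic_of_gradient hg (fun x y => ?_) x y
  calc inner ℝ (G y - G x) (y - x) ≤ ‖G y - G x‖ * ‖y - x‖ := real_inner_le_norm _ _
    _ ≤ L * ‖y - x‖ * ‖y - x‖ := by gcongr; exact hL x y
    _ = L * ‖y - x‖ ^ 2 := by ring

theorem strongConvexOn_gradient_le {g : E → ℝ} {m : ℝ} (hs : StrongConvexOn univ m g)
    {p x : E} (hg : HasGradientAt g p x) (y : E) :
    g x + inner ℝ p (y - x) + m / 2 * ‖y - x‖ ^ 2 ≤ g y := by
  have := inner_gradient_le_of_le hg (v := y - x) (A := g y - g x - m / 2 * ‖y - x‖ ^ 2)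
    (B := m / 2 * ‖y - x‖ ^ 2) (fun t ht0 ht1 => by
      have hs2 := hs.2
      have h := hs2 (mem_univ x) (mem_univ y) (a := 1 - t) (b := t) (by linarith) ht0.le (by ring)
      have e : (1 - t) • x + t • y = x + t • (y - x) := by
        rw [smul_sub, sub_smul, one_smul]; abel
      rw [e, norm_sub_rev x y] at h
      simp only [smul_eq_mul] at h
      linarith)
  linarith

/-- Cocoercivity of the gradient of a convex function that has one-sided `l`-Lipschitz gradient. -/
theorem gradient_cocoercive {g : E → ℝ} {G : E → E} (hg : ∀ x, HasGradientAt g (G x) x)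
    (hc : ∀ x y, g x + inner ℝ (G x) (y - x) ≤ g y) {l : ℝ} (hl : 0 ≤ l)
    (hL : ∀ x y, inner ℝ (G y - G x) (y - x) ≤ l * ‖y - x‖ ^ 2) (x y : E) :
    ‖G x - G y‖ ^ 2 ≤ l * inner ℝ (G x - G y) (x - y) := by
  have key : ∀ (s : ℝ) (x y : E), g y + inner ℝ (G y) (x - y) + s * inner ℝ (G x - G y) (G x - G y)
      - l / 2 * s ^ 2 * ‖G x - G y‖ ^ 2 ≤ g x := by
    intro s x y
    -- The trial point `x - s (G x - G y)` is bounded below by the tangent at `y` and above by the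
    -- parabola at `x`; adding the result to its mirror image cancels the function values.
    have h1 := hc y (x - s • (G x - G y))
    have h2 := le_quadratic_of_gradient hg hL x (x - s • (G x - G y))
    have e1 : x - s • (G x - G y) - x = -(s • (G x - G y)) := by abel
    have e2 : x - s • (G x - G y) - y = (x - y) - s • (G x - G y) := by abel
    rw [e2, inner_sub_right, inner_smul_right] at h1
    rw [e1, inner_neg_right, inner_smul_right, norm_neg, norm_smul, mul_pow, Real.norm_eq_abs,
      sq_abs] at h2
    rw [inner_sub_left]
    nlinarith
  have key2 : ∀ s : ℝ, (2 * s - l * s ^ 2) * ‖G x - G y‖ ^ 2 ≤ inner ℝ (G x - G y) (x - y) := by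
    intro s
    have h1 := key s x y
    have h2 := key s y x
    rw [real_inner_self_eq_norm_sq] at h1 h2
    rw [norm_sub_rev (G y) (G x)] at h2
    have e : inner ℝ (G x - G y) (x - y) = -inner ℝ (G y) (x - y) - inner ℝ (G x) (y - x) := by
      rw [← neg_sub x y, inner_neg_right, inner_sub_left]; ring
    rw [e]
    linarith
  have key3 : ∀ ε : ℝ, 0 < ε → ‖G x - G y‖ ^ 2 ≤ (l + ε) * inner ℝ (G x - G y) (x - y) := by
    intro ε hε
    -- The optimal `s = 1/l` is unavailable when `l = 0`; hence the perturbation `ε`, removed by a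
    -- limit.
    have h := key2 (1 / (l + ε))
    have hp : 0 < l + ε := by linarith
    have h3 : 1 / (l + ε) ≤ 2 * (1 / (l + ε)) - l * (1 / (l + ε)) ^ 2 := by
      have e : 2 * (1 / (l + ε)) - l * (1 / (l + ε)) ^ 2 - 1 / (l + ε) = ε / (l + ε) ^ 2 := by
        field_simp
        ring
      have : 0 ≤ ε / (l + ε) ^ 2 := by positivity
      linarith
    have h4 : 1 / (l + ε) * ‖G x - G y‖ ^ 2 ≤ inner ℝ (G x - G y) (x - y) :=
      le_trans (by gcongr) h
    rw [one_div, inv_mul_le_iff₀ hp] at h4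
    exact h4
  have ht : Tendsto (fun ε : ℝ => (l + ε) * inner ℝ (G x - G y) (x - y)) (𝓝[>] 0)
      (𝓝 (l * inner ℝ (G x - G y) (x - y))) := by
    have : Tendsto (fun ε : ℝ => (l + ε) * inner ℝ (G x - G y) (x - y)) (𝓝 0)
      (𝓝 ((l + 0) * inner ℝ (G x - G y) (x - y))) := by
        apply Continuous.tendsto; fun_prop
    rw [add_zero] at this
    exact this.mono_left nhdsWithin_le_nhds
  refine ge_of_tendsto ht ?_
  filter_upwards [self_mem_nhdsWithin] with ε hε using key3 ε hε

theorem hasGradientAt_half_sq (m : ℝ) (x : E) :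
    HasGradientAt (fun x : E => m / 2 * ‖x‖ ^ 2) (m • x) x := by
  rw [hasGradientAt_iff_hasFDerivAt]
  have h := ((hasStrictFDerivAt_norm_sq (F := E) x).hasFDerivAt).const_mul (m / 2)
  have e : InnerProductSpace.toDual ℝ E (m • x) = (m / 2) • (2 • (innerSL ℝ) x) := by
    ext v
    simp
    ring
  rw [e]
  exact h

/-- The strong form of cocoercivity for `m`-strongly convex functions with `L`-Lipschitz
gradient. -/
theorem strongConvexOn_gradient_cocoercive {g : E → ℝ} {G : E → E}
    (hg : ∀ x, HasGradientAt g (G x) x) {m L : ℝ} (hs : StrongConvexOn univ m g)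
    (hL : ∀ x y, ‖G y - G x‖ ≤ L * ‖y - x‖) (x y : E) :
    ‖G x - G y‖ ^ 2 + m * L * ‖x - y‖ ^ 2 ≤ (L + m) * inner ℝ (G x - G y) (x - y) := by
  -- Two distinct points are needed to deduce `m ≤ L` from the two bounds on the monotonicity of
  -- `G`.
  by_cases hxy : x = y
  · simp [hxy]
  have hmono : ∀ a b : E, m * ‖b - a‖ ^ 2 ≤ inner ℝ (G b - G a) (b - a) := by
    intro a b
    have h1 := strongConvexOn_gradient_le hs (hg a) b
    have h2 := strongConvexOn_gradient_le hs (hg b) a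
    rw [← neg_sub b a, norm_neg, inner_neg_right] at h2
    rw [inner_sub_left]
    linarith
  have hup : ∀ a b : E, inner ℝ (G b - G a) (b - a) ≤ L * ‖b - a‖ ^ 2 := fun a b =>
    calc inner ℝ (G b - G a) (b - a) ≤ ‖G b - G a‖ * ‖b - a‖ := real_inner_le_norm _ _
      _ ≤ L * ‖b - a‖ * ‖b - a‖ := by gcongr; exact hL a b
      _ = L * ‖b - a‖ ^ 2 := by ring
  have hmL : m ≤ L := by
    have hp : 0 < ‖y - x‖ ^ 2 := by
      have : 0 < ‖y - x‖ := norm_pos_iff.2 (sub_ne_zero.2 (Ne.symm hxy))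
      positivity
    exact le_of_mul_le_mul_right ((hmono x y).trans (hup x y)) hp
  -- Subtracting `m/2 ‖·‖²` leaves a convex function whose gradient has one-sided constant `L - m`;
  -- its cocoercivity expands to the claim.
  have hg' : ∀ x, HasGradientAt (fun x => g x - m / 2 * ‖x‖ ^ 2) (G x - m • x) x := by
    intro x
    have h1 := (hg x).hasFDerivAt.sub (hasGradientAt_half_sq m x).hasFDerivAt
    rw [hasGradientAt_iff_hasFDerivAt, map_sub]
    exact h1
  have e : ∀ a b : E, G b - m • b - (G a - m • a) = (G b - G a) - m • (b - a) := by
    intro a b; rw [smul_sub]; abel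
  have h := gradient_cocoercive hg' (l := L - m) (fun a b => by
      have h1 := strongConvexOn_gradient_le hs (hg a) b
      have h2 : ‖b - a‖ ^ 2 = ‖b‖ ^ 2 - 2 * inner ℝ b a + ‖a‖ ^ 2 := norm_sub_sq_real b a
      rw [inner_sub_left, inner_smul_left, inner_sub_right a b a, real_inner_self_eq_norm_sq,
        real_inner_comm]
      simp only [conj_trivial]
      rw [real_inner_comm] at h1
      rw [real_inner_comm] at h2
      rw [h2] at h1
      linarith) (by linarith) (fun a b => by
      rw [e, inner_sub_left, inner_smul_left, real_inner_self_eq_norm_sq]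
      simp only [conj_trivial]
      linarith [hup a b]) x y
  rw [e y x, inner_sub_left, inner_smul_left, real_inner_self_eq_norm_sq, norm_sub_sq_real,
    inner_smul_right, norm_smul, mul_pow, Real.norm_eq_abs, sq_abs] at h
  simp only [conj_trivial] at h
  nlinarith

end Smooth

/-! ### Minimizers of strongly convex extended-valued functions; the proximal map. -/

section Argmin

variable {d : ℕ} {φ : Euc d → EReal} {ρ : Euc d → ℝ} {m : ℝ}

theorem coe_toReal_of_mem (hb : ∀ x, φ x ≠ ⊥) {x : Euc d} (hx : x ∈ effDom φ) :
    (((φ x).toReal : ℝ) : EReal) = φ x :=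
  EReal.coe_toReal (ne_of_lt hx) (hb x)

theorem add_coe_le_iff (hb : ∀ x, φ x ≠ ⊥) {x y : Euc d} (hx : x ∈ effDom φ)
    (hy : y ∈ effDom φ) :
    φ x + (ρ x : EReal) ≤ φ y + (ρ y : EReal) ↔ (φ x).toReal + ρ x ≤ (φ y).toReal + ρ y := by
  rw [← coe_toReal_of_mem hb hx, ← coe_toReal_of_mem hb hy, ← EReal.coe_add, ← EReal.coe_add,
    EReal.coe_le_coe_iff]
  simp

theorem add_coe_le_of_notMem {x y : Euc d} (hy : y ∉ effDom φ) :
    φ x + (ρ x : EReal) ≤ φ y + (ρ y : EReal) := by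
  have : φ y = ⊤ := by simpa [effDom] using hy
  rw [this, EReal.top_add_coe]
  exact le_top

/-- A minimizer of a strongly convex function satisfies the quadratic growth condition. -/
theorem quadratic_growth_of_isMin {s : Set (Euc d)} {F : Euc d → ℝ} (hs : StrongConvexOn s m F)
    {x : Euc d} (hx : x ∈ s) (hmin : ∀ y ∈ s, F x ≤ F y) {y : Euc d} (hy : y ∈ s) :
    F x + m / 2 * ‖y - x‖ ^ 2 ≤ F y := by
  have h1' := hs.1
  have h2 := hs.2
  have key : ∀ t : ℝ, 0 < t → t < 1 → F x + m / 2 * (1 - t) * ‖y - x‖ ^ 2 ≤ F y := by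
    intro t h0 h1
    have h := h2 hx hy (a := 1 - t) (b := t) (by linarith) h0.le (by ring)
    have hz := hmin _ (h1' hx hy (a := 1 - t) (b := t) (by linarith) h0.le (by ring))
    rw [norm_sub_rev x y] at h
    simp only [smul_eq_mul] at h
    have : 0 ≤ t * (F y - (F x + m / 2 * (1 - t) * ‖y - x‖ ^ 2)) := by nlinarith
    have := nonneg_of_mul_nonneg_right this h0
    linarith
  have ht : Tendsto (fun t : ℝ => F x + m / 2 * (1 - t) * ‖y - x‖ ^ 2) (𝓝[>] 0)
      (𝓝 (F x + m / 2 * ‖y - x‖ ^ 2)) := by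
    have : Tendsto (fun t : ℝ => F x + m / 2 * (1 - t) * ‖y - x‖ ^ 2) (𝓝 0)
        (𝓝 (F x + m / 2 * (1 - 0) * ‖y - x‖ ^ 2)) := by
      apply Continuous.tendsto; fun_prop
    rw [sub_zero, mul_one] at this
    exact this.mono_left nhdsWithin_le_nhds
  refine le_of_tendsto ht ?_
  filter_upwards [Ioo_mem_nhdsGT (zero_lt_one' ℝ)] with t ht using key t ht.1 ht.2

/-- Lower semicontinuity gives minimizers on closed balls. Strong convexity makes the function
exceed its value at `x₀` outside a large ball, so the minimizer there is global. -/
theorem exists_isMin_add (hφ : IsProperClosedConvex φ) (hρ : Continuous ρ) (hm : 0 < m)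
    (hs : StrongConvexOn (effDom φ) m (fun x => (φ x).toReal + ρ x)) :
    ∃ x ∈ effDom φ, ∀ y ∈ effDom φ, (φ x).toReal + ρ x ≤ (φ y).toReal + ρ y := by
  obtain ⟨x₀, hx₀⟩ := hφ.nonempty
  have hlsc : LowerSemicontinuous (fun x => φ x + (ρ x : EReal)) := by
    refine hφ.closed.add' (continuous_coe_real_ereal.comp hρ).lowerSemicontinuous fun x => ?_
    exact EReal.continuousAt_add (Or.inr (EReal.coe_ne_bot _)) (Or.inr (EReal.coe_ne_top _))
  have hball : ∀ r : ℝ, 0 ≤ r → ∃ z ∈ effDom φ, ∀ y ∈ effDom φ, y ∈ Metric.closedBall x₀ r →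
      (φ z).toReal + ρ z ≤ (φ y).toReal + ρ y := by
    intro r hr
    have hmem : x₀ ∈ Metric.closedBall x₀ r := Metric.mem_closedBall_self hr
    obtain ⟨z, hz, hzmin⟩ := (hlsc.lowerSemicontinuousOn _).exists_isMinOn ⟨x₀, hmem⟩
      (isCompact_closedBall x₀ r)
    have hzd : z ∈ effDom φ := by
      by_contra hcon
      have h1 : φ z = ⊤ := by simpa [effDom] using hcon
      have h2 : φ z + (ρ z : EReal) ≤ φ x₀ + (ρ x₀ : EReal) := hzmin hmem
      rw [h1, EReal.top_add_coe, top_le_iff, ← coe_toReal_of_mem hφ.ne_bot hx₀,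
        ← EReal.coe_add] at h2
      exact EReal.coe_ne_top _ h2
    exact ⟨z, hzd, fun y hy hyb => (add_coe_le_iff hφ.ne_bot hzd hy).1 (hzmin hyb)⟩
  set F : Euc d → ℝ := fun x => (φ x).toReal + ρ x with hF
  obtain ⟨z, hz, hzmin⟩ := hball 1 zero_le_one
  have hzx := hzmin x₀ hx₀ (Metric.mem_closedBall_self zero_le_one)
  -- For `y` at distance `r ≥ R`, the point of the segment at distance 1 from `x₀` has value at
  -- least `F z`; strong convexity then forces `F y ≥ F x₀` once `m (r - 1) ≥ 2 (F x₀ - F z)`.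
  set R : ℝ := 1 + 2 * (F x₀ - F z) / m with hR
  have hR1 : 1 ≤ R := by
    have : 0 ≤ 2 * (F x₀ - F z) / m := div_nonneg (by simp only [hF]; linarith) hm.le
    linarith
  obtain ⟨x, hx, hxmin⟩ := hball R (by linarith)
  refine ⟨x, hx, fun y hy => ?_⟩
  by_cases hyR : y ∈ Metric.closedBall x₀ R
  · exact hxmin y hy hyR
  refine (hxmin x₀ hx₀ (Metric.mem_closedBall_self (by linarith))).trans ?_
  rw [Metric.mem_closedBall, dist_eq_norm, not_le] at hyR
  set r := ‖y - x₀‖ with hr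
  have hr0 : 0 < r := by linarith
  have hr1 : 1 / r ≤ 1 := by rw [div_le_one hr0]; linarith
  have hr2 : 0 ≤ 1 / r := by positivity
  have h1 := hs.1
  have h2 := hs.2
  have h := h2 hx₀ hy (a := 1 - 1 / r) (b := 1 / r) (by linarith) hr2 (by ring)
  have hw := hzmin _ (h1 hx₀ hy (a := 1 - 1 / r) (b := 1 / r) (by linarith) hr2 (by ring)) (by
    have e : (1 - 1 / r) • x₀ + (1 / r) • y - x₀ = (1 / r) • (y - x₀) := by
      rw [smul_sub, sub_smul, one_smul]; abel
    rw [Metric.mem_closedBall, dist_eq_norm, e, norm_smul, Real.norm_eq_abs, abs_of_nonneg hr2,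
      ← hr]
    field_simp
    exact le_rfl)
  rw [norm_sub_rev x₀ y, ← hr] at h
  simp only [smul_eq_mul] at h
  have h3 := hw.trans h
  have h4 : r * F z ≤ (r - 1) * F x₀ + F y - m / 2 * (r - 1) * r := by
    have := mul_le_mul_of_nonneg_left h3 hr0.le
    refine this.trans (le_of_eq ?_)
    simp only [hF]
    field_simp
  have h5 : 2 * (F x₀ - F z) ≤ m * (r - 1) := by
    have : 2 * (F x₀ - F z) / m ≤ r - 1 := by linarith
    rw [div_le_iff₀ hm] at this
    linarith
  change F x₀ ≤ F y
  nlinarith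

/-- Existence makes the choice in `argminPt` meaningful, and quadratic growth gives uniqueness. Both
`prox` and `uStar` are instances. -/
theorem argminPt_add (hφ : IsProperClosedConvex φ) (hρ : Continuous ρ) (hm : 0 < m)
    (hs : StrongConvexOn (effDom φ) m (fun x => (φ x).toReal + ρ x)) {x : Euc d}
    (hx : x = argminPt fun y => φ y + (ρ y : EReal)) :
    (x ∈ effDom φ ∧ ∀ y ∈ effDom φ,
      (φ x).toReal + ρ x + m / 2 * ‖y - x‖ ^ 2 ≤ (φ y).toReal + ρ y) ∧
    ∀ y, (∀ z, φ y + (ρ y : EReal) ≤ φ z + (ρ z : EReal)) ↔ y = x := by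
  have hex : ∃ x, ∀ z, φ x + (ρ x : EReal) ≤ φ z + (ρ z : EReal) := by
    obtain ⟨x, hx, hmin⟩ := exists_isMin_add hφ hρ hm hs
    refine ⟨x, fun z => ?_⟩
    by_cases hz : z ∈ effDom φ
    · exact (add_coe_le_iff hφ.ne_bot hx hz).2 (hmin z hz)
    · exact add_coe_le_of_notMem hz
  have hspec : ∀ z, φ x + (ρ x : EReal) ≤ φ z + (ρ z : EReal) := by
    rw [hx]; exact Classical.epsilon_spec hex
  have hdom : ∀ y, (∀ z, φ y + (ρ y : EReal) ≤ φ z + (ρ z : EReal)) → y ∈ effDom φ := by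
    intro y hy
    obtain ⟨x₀, hx₀⟩ := hφ.nonempty
    by_contra hcon
    have h1 : φ y = ⊤ := by simpa [effDom] using hcon
    have h2 := hy x₀
    rw [h1, EReal.top_add_coe, top_le_iff, ← coe_toReal_of_mem hφ.ne_bot hx₀,
      ← EReal.coe_add] at h2
    exact EReal.coe_ne_top _ h2
  have hgrow : ∀ y ∈ effDom φ,
      (φ x).toReal + ρ x + m / 2 * ‖y - x‖ ^ 2 ≤ (φ y).toReal + ρ y := fun y hy =>
    quadratic_growth_of_isMin hs (hdom x hspec)
      (fun z hz => (add_coe_le_iff hφ.ne_bot (hdom x hspec) hz).1 (hspec z)) hy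
  refine ⟨⟨hdom x hspec, hgrow⟩, fun y => ⟨fun hy => ?_, fun hy => hy ▸ hspec⟩⟩
  have h1 := hgrow y (hdom y hy)
  have h2 := (add_coe_le_iff hφ.ne_bot (hdom y hy) (hdom x hspec)).1 (hy x)
  have h3 : ‖y - x‖ ^ 2 ≤ 0 := by
    by_contra hcon
    push Not at hcon
    nlinarith
  have h4 : ‖y - x‖ = 0 := by
    have := sq_nonneg ‖y - x‖
    exact pow_eq_zero_iff (two_ne_zero) |>.1 (le_antisymm h3 this)
  exact sub_eq_zero.1 (norm_eq_zero.1 h4)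

theorem strongConvexOn_add_half_sq {s : Set (Euc d)} {F : Euc d → ℝ} (hs : StrongConvexOn s m F)
    {η : ℝ} (x : Euc d) :
    StrongConvexOn s (m + 1 / η) (fun y => F y + ‖y - x‖ ^ 2 / (2 * η)) := by
  refine ⟨hs.1, fun a ha b hb p q hp hq hpq => ?_⟩
  have h2 := hs.2
  have h := h2 ha hb hp hq hpq
  have hq' : q = 1 - p := by linarith
  have e : ‖p • a + q • b - x‖ ^ 2
      = p * ‖a - x‖ ^ 2 + q * ‖b - x‖ ^ 2 - p * q * ‖a - b‖ ^ 2 := by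
    have e1 : p • a + q • b - x = p • (a - x) + q • (b - x) := by
      rw [hq', smul_sub, smul_sub, sub_smul, sub_smul, one_smul, one_smul]; abel
    have e2 : a - b = (a - x) - (b - x) := by abel
    rw [e1, e2, norm_add_sq_real, norm_sub_sq_real (a - x) (b - x), norm_smul, norm_smul, mul_pow, mul_pow,
      Real.norm_eq_abs, Real.norm_eq_abs, sq_abs, sq_abs, inner_smul_left, inner_smul_right, hq']
    simp only [conj_trivial]
    ring
  simp only [smul_eq_mul] at h ⊢
  rw [e]
  have e3 : (p * ‖a - x‖ ^ 2 + q * ‖b - x‖ ^ 2 - p * q * ‖a - b‖ ^ 2) / (2 * η)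
      = p * (‖a - x‖ ^ 2 / (2 * η)) + q * (‖b - x‖ ^ 2 / (2 * η))
        - p * q * (1 / η / 2 * ‖a - b‖ ^ 2) := by
    ring
  rw [e3]
  linarith

theorem prox_spec (hφ : IsProperClosedConvex φ) (hm : 0 ≤ m)
    (hs : StrongConvexOn (effDom φ) m (fun x => (φ x).toReal)) {η : ℝ} (hη : 0 < η) (z : Euc d) :
    prox η φ z ∈ effDom φ ∧ ∀ y ∈ effDom φ,
      (φ (prox η φ z)).toReal + ‖prox η φ z - z‖ ^ 2 / (2 * η)
        + (m + 1 / η) / 2 * ‖y - prox η φ z‖ ^ 2 ≤ (φ y).toReal + ‖y - z‖ ^ 2 / (2 * η) :=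
  (argminPt_add (ρ := fun y => ‖y - z‖ ^ 2 / (2 * η)) hφ (by fun_prop) (by positivity)
    (strongConvexOn_add_half_sq hs z) rfl).1

/-- The variational inequality of the proximal point. -/
theorem prox_variational (hφ : IsProperClosedConvex φ) (hm : 0 ≤ m)
    (hs : StrongConvexOn (effDom φ) m (fun x => (φ x).toReal)) {η : ℝ} (hη : 0 < η) (z : Euc d)
    {y : Euc d} (hy : y ∈ effDom φ) :
    (φ (prox η φ z)).toReal + η⁻¹ * inner ℝ (z - prox η φ z) (y - prox η φ z)
      + m / 2 * ‖y - prox η φ z‖ ^ 2 ≤ (φ y).toReal := by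
  have h := (prox_spec hφ hm hs hη z).2 y hy
  set x := prox η φ z
  -- The `1/η` part of the growth modulus cancels the square `‖y - x‖²` in this expansion, leaving
  -- the subgradient inequality with modulus `m` alone.
  have e : ‖y - z‖ ^ 2 = ‖y - x‖ ^ 2 - 2 * inner ℝ (z - x) (y - x) + ‖x - z‖ ^ 2 := by
    have : y - z = (y - x) - (z - x) := by abel
    rw [this, norm_sub_sq_real, norm_sub_rev z x, real_inner_comm]
  have e2 : ‖y - z‖ ^ 2 / (2 * η) = 1 / η / 2 * ‖y - x‖ ^ 2 - η⁻¹ * inner ℝ (z - x) (y - x)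
      + ‖x - z‖ ^ 2 / (2 * η) := by
    rw [e]; field_simp
  rw [e2] at h
  linarith

end Argmin

/-- The Lipschitz constant `min(L_u, L_w) / (μ_H + μ_h)` of `u₀*`. -/
def Consts.lipU (c : Consts) : ℝ := min c.Lu c.Lw / (c.muH + c.muh)

theorem norm_mean_le {E : Type*} [NormedAddCommGroup E] [NormedSpace ℝ E] {n : ℕ} (hn : 0 < n)
    {a : Fin n → E} {b : ℝ} (h : ∀ i, ‖a i‖ ≤ b) : ‖(1 / (n : ℝ)) • ∑ i, a i‖ ≤ b := by
  have hn' : (0 : ℝ) < n := by exact_mod_cast hn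
  rw [norm_smul, Real.norm_eq_abs, abs_of_nonneg (by positivity), one_div, inv_mul_le_iff₀ hn']
  refine (norm_sum_le _ _).trans ((Finset.sum_le_sum fun i _ => h i).trans (le_of_eq ?_))
  simp

theorem sq_norm_mean_le {E : Type*} [NormedAddCommGroup E] [NormedSpace ℝ E] {n : ℕ} (hn : 0 < n)
    (a : Fin n → E) : ‖(1 / (n : ℝ)) • ∑ i, a i‖ ^ 2 ≤ (1 / (n : ℝ)) * ∑ i, ‖a i‖ ^ 2 := by
  have hn' : (0 : ℝ) < n := by exact_mod_cast hn
  rw [norm_smul, Real.norm_eq_abs, abs_of_nonneg (by positivity), mul_pow]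
  have h1 : ‖∑ i, a i‖ ^ 2 ≤ (∑ i, ‖a i‖) ^ 2 := by gcongr; exact norm_sum_le _ _
  have h2 : (∑ i, ‖a i‖) ^ 2 ≤ n * ∑ i, ‖a i‖ ^ 2 := by
    simpa using sq_sum_le_card_mul_sum_sq (s := Finset.univ) (f := fun i => ‖a i‖)
  calc (1 / (n : ℝ)) ^ 2 * ‖∑ i, a i‖ ^ 2
      ≤ (1 / (n : ℝ)) ^ 2 * (n * ∑ i, ‖a i‖ ^ 2) := by gcongr; exact h1.trans h2
    _ = (1 / (n : ℝ)) * ∑ i, ‖a i‖ ^ 2 := by field_simp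

/-! ### The lower level problem: `u₀*` is Lipschitz and `Φ₀` is smooth. -/

section Lower

variable {n p q : ℕ} {P : Problem n p q} {c : Consts}

theorem hasGradientAt_gradW (hA : Assumptions P c) (i : Fin n) (w : Euc p) (u : Euc q) :
    HasGradientAt (fun w' => P.H i w' u) (P.gradW i w u) w := by
  apply DifferentiableAt.hasGradientAt
  exact DifferentiableAt.comp w (g := fun z : Euc p × Euc q => P.H i z.1 z.2)
    (f := fun w' => (w', u)) (hA.diff i _) (by fun_prop)

theorem hasGradientAt_gradU (hA : Assumptions P c) (i : Fin n) (w : Euc p) (u : Euc q) :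
    HasGradientAt (fun u' => P.H i w u') (P.gradU i w u) u := by
  apply DifferentiableAt.hasGradientAt
  exact DifferentiableAt.comp u (g := fun z : Euc p × Euc q => P.H i z.1 z.2)
    (f := fun u' => (w, u')) (hA.diff i _) (by fun_prop)

theorem hasGradientAt_mean {E : Type*} [NormedAddCommGroup E] [InnerProductSpace ℝ E]
    [CompleteSpace E] {F : Fin n → E → ℝ} {G : Fin n → E} {x : E}
    (h : ∀ i, HasGradientAt (F i) (G i) x) :
    HasGradientAt (fun x => (1 / (n : ℝ)) * ∑ i, F i x) ((1 / (n : ℝ)) • ∑ i, G i) x := by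
  rw [hasGradientAt_iff_hasFDerivAt]
  have h1 := (HasFDerivAt.fun_sum (u := Finset.univ) fun i _ => (h i).hasFDerivAt).const_mul
    (1 / (n : ℝ))
  have e : InnerProductSpace.toDual ℝ E ((1 / (n : ℝ)) • ∑ i, G i)
      = (1 / (n : ℝ)) • ∑ i, InnerProductSpace.toDual ℝ E (G i) := by
    rw [map_smul, map_sum]
  rw [e]
  exact h1

theorem hasGradientAt_mean_gradW (hA : Assumptions P c) (w : Euc p) (u : Euc q) :
    HasGradientAt (fun w' => P.Hbar w' u) ((1 / (n : ℝ)) • ∑ i, P.gradW i w u) w :=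
  hasGradientAt_mean fun i => hasGradientAt_gradW hA i w u

theorem hasGradientAt_mean_gradU (hA : Assumptions P c) (w : Euc p) (u : Euc q) :
    HasGradientAt (fun u' => P.Hbar w u') ((1 / (n : ℝ)) • ∑ i, P.gradU i w u) u :=
  hasGradientAt_mean fun i => hasGradientAt_gradU hA i w u

theorem gradWbar_eq (hA : Assumptions P c) (w : Euc p) (u : Euc q) :
    P.gradWbar w u = (1 / (n : ℝ)) • ∑ i, P.gradW i w u :=
  (hasGradientAt_mean_gradW hA w u).gradient

theorem gradUbar_eq (hA : Assumptions P c) (w : Euc p) (u : Euc q) :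
    P.gradUbar w u = (1 / (n : ℝ)) • ∑ i, P.gradU i w u :=
  (hasGradientAt_mean_gradU hA w u).gradient

theorem hasGradientAt_gradWbar (hA : Assumptions P c) (w : Euc p) (u : Euc q) :
    HasGradientAt (fun w' => P.Hbar w' u) (P.gradWbar w u) w := by
  rw [gradWbar_eq hA]; exact hasGradientAt_mean_gradW hA w u

theorem hasGradientAt_gradUbar (hA : Assumptions P c) (w : Euc p) (u : Euc q) :
    HasGradientAt (fun u' => P.Hbar w u') (P.gradUbar w u) u := by
  rw [gradUbar_eq hA]; exact hasGradientAt_mean_gradU hA w u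

theorem gradWbar_lip_w (hc : c.Valid) (hn : 0 < n) (hA : Assumptions P c) (w w' : Euc p)
    (u : Euc q) : ‖P.gradWbar w u - P.gradWbar w' u‖ ≤ c.Lw * ‖w - w'‖ := by
  rw [gradWbar_eq hA, gradWbar_eq hA, ← smul_sub, ← Finset.sum_sub_distrib]
  refine norm_mean_le hn fun i => ?_
  have h := hA.H_lip i w u w' u
  rw [sub_self u, norm_zero] at h
  refine abs_le_of_sq_le_sq' ?_ (mul_nonneg hc.Lw_pos.le (norm_nonneg _)) |>.2
  nlinarith [sq_nonneg ‖P.gradU i w u - P.gradU i w' u‖]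

theorem gradWbar_lip_u (hc : c.Valid) (hn : 0 < n) (hA : Assumptions P c) (w : Euc p)
    (u u' : Euc q) : ‖P.gradWbar w u - P.gradWbar w u'‖ ≤ c.Lu * ‖u - u'‖ := by
  rw [gradWbar_eq hA, gradWbar_eq hA, ← smul_sub, ← Finset.sum_sub_distrib]
  refine norm_mean_le hn fun i => ?_
  have h := hA.H_lip i w u w u'
  rw [sub_self w, norm_zero] at h
  refine abs_le_of_sq_le_sq' ?_ (mul_nonneg hc.Lu_pos.le (norm_nonneg _)) |>.2
  nlinarith [sq_nonneg ‖P.gradU i w u - P.gradU i w u'‖]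

theorem gradUbar_lip_w (hc : c.Valid) (hn : 0 < n) (hA : Assumptions P c) (w w' : Euc p)
    (u : Euc q) : ‖P.gradUbar w u - P.gradUbar w' u‖ ≤ c.Lw * ‖w - w'‖ := by
  rw [gradUbar_eq hA, gradUbar_eq hA, ← smul_sub, ← Finset.sum_sub_distrib]
  refine norm_mean_le hn fun i => ?_
  have h := hA.H_lip i w u w' u
  rw [sub_self u, norm_zero] at h
  refine abs_le_of_sq_le_sq' ?_ (mul_nonneg hc.Lw_pos.le (norm_nonneg _)) |>.2
  nlinarith [sq_nonneg ‖P.gradW i w u - P.gradW i w' u‖]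

theorem gradUbar_lip_u (hc : c.Valid) (hn : 0 < n) (hA : Assumptions P c) (w : Euc p)
    (u u' : Euc q) : ‖P.gradUbar w u - P.gradUbar w u'‖ ≤ c.Lu * ‖u - u'‖ := by
  rw [gradUbar_eq hA, gradUbar_eq hA, ← smul_sub, ← Finset.sum_sub_distrib]
  refine norm_mean_le hn fun i => ?_
  have h := hA.H_lip i w u w u'
  rw [sub_self w, norm_zero] at h
  refine abs_le_of_sq_le_sq' ?_ (mul_nonneg hc.Lu_pos.le (norm_nonneg _)) |>.2
  nlinarith [sq_nonneg ‖P.gradW i w u - P.gradW i w u'‖]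

theorem strongConvexOn_neg_Hbar (hn : 0 < n) (hA : Assumptions P c) (w : Euc p) :
    StrongConvexOn univ c.muH (fun u => -P.Hbar w u) := by
  have hn' : (0 : ℝ) < n := by exact_mod_cast hn
  refine ⟨convex_univ, fun a _ b _ s t hs ht hst => ?_⟩
  have h : ∀ i, s * P.H i w a + t * P.H i w b + s * t * (c.muH / 2 * ‖a - b‖ ^ 2)
      ≤ P.H i w (s • a + t • b) := fun i => by
    have h2 := (hA.H_strong i w).2
    exact h2 (mem_univ a) (mem_univ b) hs ht hst
  have h3 := Finset.sum_le_sum fun i (_ : i ∈ Finset.univ) => h i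
  rw [Finset.sum_add_distrib, Finset.sum_add_distrib, ← Finset.mul_sum, ← Finset.mul_sum,
    Finset.sum_const, Finset.card_univ, Fintype.card_fin, nsmul_eq_mul] at h3
  have h4 := mul_le_mul_of_nonneg_left h3 (by positivity : 0 ≤ 1 / (n : ℝ))
  have e : 1 / (n : ℝ) * (n * (s * t * (c.muH / 2 * ‖a - b‖ ^ 2)))
      = s * t * (c.muH / 2 * ‖a - b‖ ^ 2) := by field_simp
  rw [mul_add, e, mul_add] at h4
  simp only [Problem.Hbar, smul_eq_mul]
  linarith

theorem strongConvexOn_h_sub_Hbar (hn : 0 < n) (hA : Assumptions P c) (w : Euc p) :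
    StrongConvexOn (effDom P.h) (c.muH + c.muh) (fun u => (P.h u).toReal + -P.Hbar w u) := by
  refine ⟨hA.h_strong.1, fun a ha b hb s t hs ht hst => ?_⟩
  have h1 := hA.h_strong.2
  have h2 := (strongConvexOn_neg_Hbar hn hA w).2
  have h3 := h1 ha hb hs ht hst
  have h4 := h2 (mem_univ a) (mem_univ b) hs ht hst
  simp only [smul_eq_mul] at h3 h4 ⊢
  linarith

theorem continuous_Hbar (hA : Assumptions P c) (w : Euc p) : Continuous fun u => P.Hbar w u :=
  continuous_iff_continuousAt.2 fun u => (hasGradientAt_gradUbar hA w u).continuousAt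

theorem sub_Hbar_eq (w : Euc p) (u : Euc q) :
    P.h u - ((P.Hbar w u : ℝ) : EReal) = P.h u + ((-P.Hbar w u : ℝ) : EReal) := by
  rw [EReal.coe_neg, sub_eq_add_neg]

theorem uStar_spec (hc : c.Valid) (hn : 0 < n) (hA : Assumptions P c) (w : Euc p) :
    (P.uStar w ∈ effDom P.h ∧ ∀ y ∈ effDom P.h,
      (P.h (P.uStar w)).toReal + -P.Hbar w (P.uStar w)
        + (c.muH + c.muh) / 2 * ‖y - P.uStar w‖ ^ 2 ≤ (P.h y).toReal + -P.Hbar w y) ∧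
    ∀ y, (∀ z, P.h y - ((P.Hbar w y : ℝ) : EReal) ≤ P.h z - ((P.Hbar w z : ℝ) : EReal)) ↔
      y = P.uStar w := by
  simp only [sub_Hbar_eq]
  refine argminPt_add (ρ := fun u => -P.Hbar w u) hA.h_pcc (continuous_Hbar hA w).neg hc.mu_pos
    (strongConvexOn_h_sub_Hbar hn hA w) ?_
  simp only [Problem.uStar, sub_Hbar_eq]

theorem Phi_eq (hc : c.Valid) (hn : 0 < n) (hA : Assumptions P c) (w : Euc p) :
    P.Phi w = ((P.Hbar w (P.uStar w) - (P.h (P.uStar w)).toReal : ℝ) : EReal) := by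
  obtain ⟨⟨hu, hmin⟩, -⟩ := uStar_spec hc hn hA w
  apply le_antisymm
  · refine iSup_le fun u => ?_
    by_cases hud : u ∈ effDom P.h
    · rw [← coe_toReal_of_mem hA.h_pcc.ne_bot hud, ← EReal.coe_sub, EReal.coe_le_coe_iff]
      have := hmin u hud
      have h0 : 0 ≤ (c.muH + c.muh) / 2 * ‖u - P.uStar w‖ ^ 2 :=
        mul_nonneg (by linarith [hc.mu_pos]) (sq_nonneg _)
      linarith
    · have : P.h u = ⊤ := by simpa [effDom] using hud
      rw [this, EReal.sub_top]
      exact bot_le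
  · rw [EReal.coe_sub, coe_toReal_of_mem hA.h_pcc.ne_bot hu]
    exact le_iSup (fun u => ((P.Hbar w u : ℝ) : EReal) - P.h u) (P.uStar w)

theorem Phi_toReal (hc : c.Valid) (hn : 0 < n) (hA : Assumptions P c) (w : Euc p) :
    (P.Phi w).toReal = P.Hbar w (P.uStar w) - (P.h (P.uStar w)).toReal := by
  rw [Phi_eq hc hn hA, EReal.toReal_coe]

theorem le_Phi_toReal (hc : c.Valid) (hn : 0 < n) (hA : Assumptions P c) (w : Euc p) {u : Euc q}
    (hu : u ∈ effDom P.h) : P.Hbar w u - (P.h u).toReal ≤ (P.Phi w).toReal := by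
  have := (uStar_spec hc hn hA w).1.2 u hu
  have h0 : 0 ≤ (c.muH + c.muh) / 2 * ‖u - P.uStar w‖ ^ 2 :=
    mul_nonneg (by linarith [hc.mu_pos]) (sq_nonneg _)
  rw [Phi_toReal hc hn hA]
  linarith

theorem norm_sub_le_of_gradient {E : Type*} [NormedAddCommGroup E] [InnerProductSpace ℝ E]
    [CompleteSpace E] {F : E → ℝ} {G : E → E} (h : ∀ x, HasGradientAt F (G x) x) {b : ℝ}
    (hb : ∀ x, ‖G x‖ ≤ b) (x y : E) : F y - F x ≤ b * ‖y - x‖ := by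
  have := Convex.norm_image_sub_le_of_norm_hasFDerivWithin_le (s := univ) (C := b)
    (fun x _ => (h x).hasFDerivAt.hasFDerivWithinAt)
    (fun x _ => by simpa using hb x) convex_univ (mem_univ x) (mem_univ y)
  exact (le_abs_self _).trans this

/-- Mixed second differences of `H`. -/
theorem mixed_difference_le (hc : c.Valid) (hn : 0 < n) (hA : Assumptions P c) (w w' : Euc p)
    (u u' : Euc q) : (P.Hbar w u - P.Hbar w u') - (P.Hbar w' u - P.Hbar w' u')
      ≤ min c.Lu c.Lw * ‖u - u'‖ * ‖w - w'‖ := by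
  have hsub : ∀ {E : Type} [NormedAddCommGroup E] [InnerProductSpace ℝ E] [CompleteSpace E]
      {f g : E → ℝ} {a b x : E}, HasGradientAt f a x → HasGradientAt g b x →
      HasGradientAt (fun x => f x - g x) (a - b) x := by
    intro E _ _ _ f g a b x hf hg
    rw [hasGradientAt_iff_hasFDerivAt, map_sub]
    exact hf.hasFDerivAt.sub hg.hasFDerivAt
  -- The mean value inequality in `w` gives the constant `L_u`; in `u` it gives `L_w`.
  rw [min_mul_of_nonneg _ _ (norm_nonneg _), min_mul_of_nonneg _ _ (norm_nonneg _)]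
  refine le_min ?_ ?_
  · exact norm_sub_le_of_gradient (F := fun w => P.Hbar w u - P.Hbar w u')
      (fun w => hsub (hasGradientAt_gradWbar hA w u) (hasGradientAt_gradWbar hA w u'))
      (fun w => gradWbar_lip_u hc hn hA w u u') w' w
  · have h := norm_sub_le_of_gradient (F := fun u => P.Hbar w u - P.Hbar w' u)
      (fun u => hsub (hasGradientAt_gradUbar hA w u) (hasGradientAt_gradUbar hA w' u))
      (fun u => gradUbar_lip_w hc hn hA w w' u) u' u
    rw [mul_right_comm]
    linarith

/-- In the sum of the growth inequalities at the two maximizers, the values of `h` cancel and a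
mixed second difference of `H` remains. -/
theorem uStar_lip (hc : c.Valid) (hn : 0 < n) (hA : Assumptions P c) (w w' : Euc p) :
    ‖P.uStar w - P.uStar w'‖ ≤ c.lipU * ‖w - w'‖ := by
  obtain ⟨⟨hu, hmin⟩, -⟩ := uStar_spec hc hn hA w
  obtain ⟨⟨hu', hmin'⟩, -⟩ := uStar_spec hc hn hA w'
  have h1 := hmin _ hu'
  have h2 := hmin' _ hu
  rw [norm_sub_rev] at h1
  have h3 := mixed_difference_le hc hn hA w w' (P.uStar w) (P.uStar w')
  have h4 : (c.muH + c.muh) * ‖P.uStar w - P.uStar w'‖ ^ 2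
      ≤ min c.Lu c.Lw * ‖P.uStar w - P.uStar w'‖ * ‖w - w'‖ := by linarith
  have hm : 0 ≤ min c.Lu c.Lw := le_min hc.Lu_pos.le hc.Lw_pos.le
  rw [Consts.lipU, div_mul_eq_mul_div, le_div_iff₀ hc.mu_pos]
  by_cases h0 : ‖P.uStar w - P.uStar w'‖ = 0
  · rw [h0, zero_mul]; positivity
  · have hp : 0 < ‖P.uStar w - P.uStar w'‖ := lt_of_le_of_ne (norm_nonneg _) (Ne.symm h0)
    refine le_of_mul_le_mul_left ?_ hp
    nlinarith

theorem lipU_pos (hc : c.Valid) : 0 < c.lipU :=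
  div_pos (lt_min hc.Lu_pos hc.Lw_pos) hc.mu_pos

theorem lipU_le_kappa (hc : c.Valid) : c.lipU ≤ c.kappa :=
  div_le_div_of_nonneg_right (min_le_left _ _) hc.mu_pos.le

/-- The minimum in `lipU` serves two purposes: the `L_w` branch, used here, yields the smoothness
constant `L_{Φ₀} = (1 + κ) L_w`, while the `L_u` branch bounds the motion of `u₀*` by `κ`, as in the
third step size condition. -/
theorem Lu_mul_lipU_le (hc : c.Valid) : c.Lu * c.lipU ≤ c.kappa * c.Lw := by
  rw [Consts.lipU, Consts.kappa, mul_div_assoc', div_mul_eq_mul_div]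
  exact div_le_div_of_nonneg_right
    (mul_le_mul_of_nonneg_left (min_le_right _ _) hc.Lu_pos.le) hc.mu_pos.le

/-- Danskin's theorem. -/
theorem hasGradientAt_Phi (hc : c.Valid) (hn : 0 < n) (hA : Assumptions P c) (w : Euc p) :
    HasGradientAt (fun w => (P.Phi w).toReal) (P.gradWbar w (P.uStar w)) w := by
  -- Freezing the maximizer `u₀*(w)` gives a minorant of `Φ₀` that touches it at `w`.
  have hlow : ∀ w', (P.Phi w).toReal + inner ℝ (P.gradWbar w (P.uStar w)) (w' - w)
      - c.Lw / 2 * ‖w' - w‖ ^ 2 ≤ (P.Phi w').toReal := by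
    intro w'
    have h1 := le_Phi_toReal hc hn hA w' (uStar_spec hc hn hA w).1.1
    have h2 := le_quadratic_of_lipschitz_gradient (g := fun x => -P.Hbar x (P.uStar w))
      (G := fun x => -P.gradWbar x (P.uStar w)) (L := c.Lw) (fun x => by
        rw [hasGradientAt_iff_hasFDerivAt, map_neg]
        exact (hasGradientAt_gradWbar hA x _).hasFDerivAt.neg) (fun x y => by
        rw [neg_sub_neg, norm_sub_rev]
        exact gradWbar_lip_w hc hn hA y x _) w w'
    rw [inner_neg_left] at h2
    rw [Phi_toReal hc hn hA w]
    linarith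
  -- Freezing `u₀*(w')` gives the upper bound; replacing it by `u₀*(w)` in the gradient costs only a
  -- quadratic term. Together the two bounds give differentiability.
  have hup : ∀ w', (P.Phi w').toReal ≤ (P.Phi w).toReal
      + inner ℝ (P.gradWbar w (P.uStar w)) (w' - w)
      + (c.Lw / 2 + c.Lu * c.lipU) * ‖w' - w‖ ^ 2 := by
    intro w'
    have h1 := le_Phi_toReal hc hn hA w (uStar_spec hc hn hA w').1.1
    have h2 := le_quadratic_of_lipschitz_gradient (g := fun x => P.Hbar x (P.uStar w'))
      (G := fun x => P.gradWbar x (P.uStar w')) (L := c.Lw)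
      (fun x => hasGradientAt_gradWbar hA x _)
      (fun x y => gradWbar_lip_w hc hn hA y x _) w w'
    have h3 : inner ℝ (P.gradWbar w (P.uStar w') - P.gradWbar w (P.uStar w)) (w' - w)
        ≤ c.Lu * c.lipU * ‖w' - w‖ ^ 2 := by
      calc inner ℝ (P.gradWbar w (P.uStar w') - P.gradWbar w (P.uStar w)) (w' - w)
          ≤ ‖P.gradWbar w (P.uStar w') - P.gradWbar w (P.uStar w)‖ * ‖w' - w‖ :=
            real_inner_le_norm _ _
        _ ≤ c.Lu * (c.lipU * ‖w' - w‖) * ‖w' - w‖ := by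
            gcongr
            refine (gradWbar_lip_u hc hn hA w _ _).trans ?_
            exact mul_le_mul_of_nonneg_left (uStar_lip hc hn hA w' w) hc.Lu_pos.le
        _ = c.Lu * c.lipU * ‖w' - w‖ ^ 2 := by ring
    rw [inner_sub_left] at h3
    rw [Phi_toReal hc hn hA w']
    linarith
  rw [hasGradientAt_iff_isLittleO]
  refine Asymptotics.IsBigO.trans_isLittleO (g := fun w' => ‖w' - w‖ ^ 2) ?_ ?_
  · refine Asymptotics.IsBigO.of_bound (c.Lw / 2 + c.Lu * c.lipU) (Eventually.of_forall fun w' => ?_)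
    have h0 : 0 ≤ c.Lu * c.lipU * ‖w' - w‖ ^ 2 :=
      mul_nonneg (mul_nonneg hc.Lu_pos.le (lipU_pos hc).le) (sq_nonneg _)
    rw [Real.norm_eq_abs, Real.norm_eq_abs, abs_of_nonneg (sq_nonneg ‖w' - w‖), abs_le]
    constructor <;> linarith [hlow w', hup w']
  · have := (Asymptotics.isLittleO_norm_pow_id (E' := Euc p) (n := 2) (by norm_num))
    have h2 := this.comp_tendsto (k := fun w' => w' - w) (l' := 𝓝 w) (by
      have : Tendsto (fun w' => w' - w) (𝓝 w) (𝓝 (w - w)) := by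
        apply Continuous.tendsto; fun_prop
      simpa using this)
    exact h2

theorem gradPhi_eq (hc : c.Valid) (hn : 0 < n) (hA : Assumptions P c) (w : Euc p) :
    P.gradPhi w = P.gradWbar w (P.uStar w) :=
  (hasGradientAt_Phi hc hn hA w).gradient

theorem gradPhi_lip (hc : c.Valid) (hn : 0 < n) (hA : Assumptions P c) (w w' : Euc p) :
    ‖P.gradPhi w - P.gradPhi w'‖ ≤ (c.Lw + c.Lu * c.lipU) * ‖w - w'‖ := by
  rw [gradPhi_eq hc hn hA, gradPhi_eq hc hn hA]
  calc _ = ‖(P.gradWbar w (P.uStar w) - P.gradWbar w' (P.uStar w))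
          + (P.gradWbar w' (P.uStar w) - P.gradWbar w' (P.uStar w'))‖ := by
        congr 1; abel
    _ ≤ c.Lw * ‖w - w'‖ + c.Lu * (c.lipU * ‖w - w'‖) := by
        refine (norm_add_le _ _).trans (add_le_add (gradWbar_lip_w hc hn hA _ _ _) ?_)
        refine (gradWbar_lip_u hc hn hA _ _ _).trans ?_
        exact mul_le_mul_of_nonneg_left (uStar_lip hc hn hA w w') hc.Lu_pos.le
    _ = _ := by ring

theorem Phi_descent (hc : c.Valid) (hn : 0 < n) (hA : Assumptions P c) (w w' : Euc p) :
    (P.Phi w').toReal ≤ (P.Phi w).toReal + inner ℝ (P.gradPhi w) (w' - w)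
      + (c.Lw + c.Lu * c.lipU) / 2 * ‖w' - w‖ ^ 2 :=
  le_quadratic_of_lipschitz_gradient (g := fun w => (P.Phi w).toReal) (G := P.gradPhi)
    (fun x => by rw [gradPhi_eq hc hn hA]; exact hasGradientAt_Phi hc hn hA x)
    (fun x y => gradPhi_lip hc hn hA y x) w w'

end Lower

/-- The folds over prefixes turn the loop into a recursively described sequence, suited to
induction. -/
theorem exists_seq_foldl_finRange {α : Type*} {n : ℕ} (f : α → Fin n → α) (a : α) :
    ∃ x : ℕ → α, x 0 = a ∧ (∀ i : Fin n, x (i + 1) = f (x i) i) ∧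
      (List.finRange n).foldl f a = x n := by
  refine ⟨fun k => ((List.finRange n).take k).foldl f a, by simp, fun i => ?_, ?_⟩
  · have hi : (i : ℕ) < (List.finRange n).length := by simp
    simp only
    rw [List.take_succ_eq_append_getElem hi, List.foldl_append]
    simp
  · simp only
    rw [List.take_of_length_le (by simp)]

theorem foldl_add_count {E : Type*} [AddCommMonoid E] {ι : Type*} (g : ι → E) (l : List ι) (e : E)
    (k : ℕ) : l.foldl (fun (a : E × ℕ) i => (a.1 + g i, a.2 + 1)) (e, k)
      = (e + (l.map g).sum, k + l.length) := by
  induction l generalizing e k with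
  | nil => simp
  | cons i l ih =>
    rw [List.foldl_cons, ih]
    simp [add_assoc, add_comm 1]

/-! ### Contraction of the ascent steps and anatomy of one epoch. -/

section Ascent

variable {n p q : ℕ} {P : Problem n p q} {c : Consts}

/-- First-order optimality of `u₀*(w)`, obtained along the segment to `y` since only `H` is
differentiable. -/
theorem uStar_variational (hc : c.Valid) (hn : 0 < n) (hA : Assumptions P c) (w : Euc p)
    {y : Euc q} (hy : y ∈ effDom P.h) :
    (P.h (P.uStar w)).toReal + inner ℝ (P.gradUbar w (P.uStar w)) (y - P.uStar w)
      + c.muh / 2 * ‖y - P.uStar w‖ ^ 2 ≤ (P.h y).toReal := by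
  have hu := (uStar_spec hc hn hA w).1.1
  have h1 := hA.h_strong.1
  have h2 := hA.h_strong.2
  have := inner_gradient_le_of_le (hasGradientAt_gradUbar hA w (P.uStar w)) (v := y - P.uStar w)
    (A := (P.h y).toReal - (P.h (P.uStar w)).toReal - c.muh / 2 * ‖y - P.uStar w‖ ^ 2)
    (B := c.muh / 2 * ‖y - P.uStar w‖ ^ 2) (fun t ht0 ht1 => by
      have hd := h1 hu hy (a := 1 - t) (b := t) (by linarith) ht0.le (by ring)
      have h := h2 hu hy (a := 1 - t) (b := t) (by linarith) ht0.le (by ring)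
      have e : (1 - t) • P.uStar w + t • y = P.uStar w + t • (y - P.uStar w) := by
        rw [smul_sub, sub_smul, one_smul]; abel
      have h3 := le_Phi_toReal hc hn hA w hd
      rw [Phi_toReal hc hn hA] at h3
      rw [e] at h h3
      rw [norm_sub_rev (P.uStar w) y] at h
      simp only [smul_eq_mul] at h
      linarith)
  linarith

/-- In the expanded square, the condition `η̂ ≤ 2/(L_u + μ_H)` lets strong cocoercivity absorb the
term `η̂² ‖g‖²`. -/
theorem gradient_ascent_contraction (hc : c.Valid) (hn : 0 < n) (hA : Assumptions P c) {ηh : ℝ}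
    (h0 : 0 < ηh) (h1 : ηh ≤ 2 / (c.Lu + c.muH)) (w : Euc p) (u v : Euc q) :
    ‖(u + ηh • P.gradUbar w u) - (v + ηh • P.gradUbar w v)‖ ^ 2
      ≤ (1 - 2 * (ηh * (c.muH * c.Lu / (c.Lu + c.muH)))) * ‖u - v‖ ^ 2 := by
  have hp : 0 < c.Lu + c.muH := by linarith [hc.Lu_pos, hc.muH_nonneg]
  have h := strongConvexOn_gradient_cocoercive (g := fun u => -P.Hbar w u)
    (G := fun u => -P.gradUbar w u) (L := c.Lu) (fun x => by
      rw [hasGradientAt_iff_hasFDerivAt, map_neg]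
      exact (hasGradientAt_gradUbar hA w x).hasFDerivAt.neg)
    (strongConvexOn_neg_Hbar hn hA w)
    (fun x y => by
      rw [neg_sub_neg, norm_sub_rev]; exact gradUbar_lip_u hc hn hA w y x) u v
  set g := -P.gradUbar w u - -P.gradUbar w v with hg
  have e : (u + ηh • P.gradUbar w u) - (v + ηh • P.gradUbar w v) = (u - v) - ηh • g := by
    rw [hg, smul_sub, smul_neg, smul_neg]; abel
  rw [e, norm_sub_sq_real, norm_smul, mul_pow, Real.norm_eq_abs, sq_abs, inner_smul_right,
    real_inner_comm]
  have h2 : ‖g‖ ^ 2 / (c.Lu + c.muH) + c.muH * c.Lu / (c.Lu + c.muH) * ‖u - v‖ ^ 2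
      ≤ inner ℝ g (u - v) := by
    have : ‖g‖ ^ 2 / (c.Lu + c.muH) + c.muH * c.Lu / (c.Lu + c.muH) * ‖u - v‖ ^ 2
        = (‖g‖ ^ 2 + c.muH * c.Lu * ‖u - v‖ ^ 2) / (c.Lu + c.muH) := by ring
    rw [this, div_le_iff₀ hp]
    linarith
  have h3 : ηh * ‖g‖ ^ 2 ≤ 2 * (‖g‖ ^ 2 / (c.Lu + c.muH)) := by
    calc ηh * ‖g‖ ^ 2 ≤ 2 / (c.Lu + c.muH) * ‖g‖ ^ 2 := by gcongr
      _ = _ := by ring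
  nlinarith

theorem B0_pos (hc : c.Valid) {ηh : ℝ} (h0 : 0 < ηh) : 0 < c.B0 ηh := by
  have hp : 0 < c.Lu + c.muH := by linarith [hc.Lu_pos, hc.muH_nonneg]
  have hL := hc.Lu_pos
  have hm := hc.muH_nonneg
  have hm' := hc.muh_nonneg
  refine mul_pos h0 ?_
  rcases hm.lt_or_eq with h | h
  · have : 0 < c.muH * c.Lu / (c.Lu + c.muH) := by positivity
    linarith
  · have := hc.mu_pos
    rw [← h] at this ⊢
    simpa using this

/-- The two variational inequalities at the new point and at `u₀*(w)` gain a factor `1 + η̂ μ_h`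
from the prox; the gradient step gains `1 + a`. Their product is at least `1 + B₀`. -/
theorem prox_ascent_contraction (hc : c.Valid) (hn : 0 < n) (hA : Assumptions P c) {ηh : ℝ}
    (h0 : 0 < ηh) (h1 : ηh ≤ 2 / (c.Lu + c.muH)) (w : Euc p) (u : Euc q) :
    (1 + c.B0 ηh) * ‖prox ηh P.h (u + ηh • P.gradUbar w u) - P.uStar w‖ ≤ ‖u - P.uStar w‖ := by
  have hL := hc.Lu_pos
  have hm := hc.muH_nonneg
  have hm' := hc.muh_nonneg
  have hgrad := gradient_ascent_contraction hc hn hA h0 h1 w u (P.uStar w)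
  set z := u + ηh • P.gradUbar w u with hz
  set us := P.uStar w with hus
  set g := P.gradUbar w us with hgdef
  have hdom : us ∈ effDom P.h := (uStar_spec hc hn hA w).1.1
  have hp1 := (prox_spec hA.h_pcc hc.muh_nonneg hA.h_strong h0 z).1
  have hv := prox_variational hA.h_pcc hc.muh_nonneg hA.h_strong h0 z hdom
  have hv' := uStar_variational hc hn hA w hp1
  rw [← hus, ← hgdef] at hv'
  set x := prox ηh P.h z with hx
  have h2 : ηh⁻¹ * inner ℝ (z - x) (us - x) + inner ℝ g (x - us) + c.muh * ‖x - us‖ ^ 2 ≤ 0 := by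
    rw [norm_sub_rev us x] at hv
    linarith
  have h3 : inner ℝ (z - x) (us - x) + ηh * inner ℝ g (x - us) + ηh * c.muh * ‖x - us‖ ^ 2
      ≤ 0 := by
    have := mul_nonpos_of_nonneg_of_nonpos h0.le h2
    rw [mul_add, mul_add, mul_inv_cancel_left₀ h0.ne'] at this
    linarith
  have h4 : (1 + ηh * c.muh) * ‖x - us‖ ^ 2 ≤ inner ℝ (z - (us + ηh • g)) (x - us) := by
    have e : z - (us + ηh • g) = (z - x) + (x - us) - ηh • g := by abel
    rw [e, inner_sub_left, inner_add_left, inner_smul_left, real_inner_self_eq_norm_sq]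
    have : inner ℝ (z - x) (us - x) = -inner ℝ (z - x) (x - us) := by
      rw [← inner_neg_right, neg_sub]
    simp only [conj_trivial]
    linarith
  have h5 : (1 + ηh * c.muh) * ‖x - us‖ ≤ ‖z - (us + ηh • g)‖ := by
    by_cases hzero : ‖x - us‖ = 0
    · rw [hzero, mul_zero]; exact norm_nonneg _
    · have hpos : 0 < ‖x - us‖ := lt_of_le_of_ne (norm_nonneg _) (Ne.symm hzero)
      refine le_of_mul_le_mul_right ?_ hpos
      have := h4.trans (real_inner_le_norm _ _)
      linarith
  set a := ηh * (c.muH * c.Lu / (c.Lu + c.muH)) with ha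
  have ha0 : 0 ≤ a := by positivity
  have hb0 : 0 ≤ ηh * c.muh := by positivity
  -- The squared contraction factor is `1 - 2a`, and `(1 + a)² (1 - 2a) = 1 - 3a² - 2a³ ≤ 1`.
  have h6 : ((1 + a) * ‖z - (us + ηh • g)‖) ^ 2 ≤ ‖u - us‖ ^ 2 := by
    rw [mul_pow]
    calc (1 + a) ^ 2 * ‖z - (us + ηh • g)‖ ^ 2
        ≤ (1 + a) ^ 2 * ((1 - 2 * a) * ‖u - us‖ ^ 2) := by gcongr
      _ = (1 - (3 * a ^ 2 + 2 * a ^ 3)) * ‖u - us‖ ^ 2 := by ring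
      _ ≤ 1 * ‖u - us‖ ^ 2 := by
          gcongr
          have : 0 ≤ 3 * a ^ 2 + 2 * a ^ 3 := by positivity
          linarith
      _ = ‖u - us‖ ^ 2 := one_mul _
  have h7 : (1 + a) * ‖z - (us + ηh • g)‖ ≤ ‖u - us‖ := abs_le_of_sq_le_sq' h6 (norm_nonneg _) |>.2
  have hB : 1 + c.B0 ηh ≤ (1 + a) * (1 + ηh * c.muh) := by
    have : c.B0 ηh = ηh * c.muh + a := by rw [Consts.B0, ha]; ring
    rw [this]
    nlinarith [mul_nonneg ha0 hb0]
  calc (1 + c.B0 ηh) * ‖x - us‖ ≤ (1 + a) * (1 + ηh * c.muh) * ‖x - us‖ := by gcongr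
    _ = (1 + a) * ((1 + ηh * c.muh) * ‖x - us‖) := by ring
    _ ≤ (1 + a) * ‖z - (us + ηh • g)‖ := by gcongr
    _ ≤ _ := h7

theorem ascentStep_eq (hA : Assumptions P c) (ηh : ℝ) (s : State p q) :
    P.ascentStep ηh s = { s with
      u := prox ηh P.h (s.u + ηh • P.gradUbar s.w s.u)
      evalU := s.evalU + n
      evalProxH := s.evalProxH + 1 } := by
  have e : ((List.finRange n).map fun i => P.gradU i s.w s.u).sum = ∑ i, P.gradU i s.w s.u := by
    rw [← List.ofFn_eq_map, List.sum_ofFn]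
  simp only [Problem.ascentStep, foldl_add_count, zero_add, List.length_finRange, e]
  rw [gradUbar_eq hA, smul_smul, mul_one_div]

theorem iterate_ascentStep (hc : c.Valid) (hn : 0 < n) (hA : Assumptions P c) {ηh : ℝ}
    (h0 : 0 < ηh) (h1 : ηh ≤ 2 / (c.Lu + c.muH)) (s : State p q) (S : ℕ) :
    ((P.ascentStep ηh)^[S] s).w = s.w ∧
    ((P.ascentStep ηh)^[S] s).evalW = s.evalW ∧
    ((P.ascentStep ηh)^[S] s).evalU = s.evalU + S * n ∧
    ((P.ascentStep ηh)^[S] s).evalProxF = s.evalProxF ∧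
    ((P.ascentStep ηh)^[S] s).evalProxH = s.evalProxH + S ∧
    (1 + c.B0 ηh) ^ S * ‖((P.ascentStep ηh)^[S] s).u - P.uStar s.w‖ ≤ ‖s.u - P.uStar s.w‖ := by
  induction S with
  | zero => simp
  | succ S ih =>
    rw [Function.iterate_succ_apply', ascentStep_eq hA]
    set t := (P.ascentStep ηh)^[S] s
    obtain ⟨e1, e2, e3, e4, e5, h⟩ := ih
    refine ⟨e1, e2, ?_, e4, ?_, ?_⟩
    · simp only [e3]; ring
    · simp only [e5]; ring
    · have hB := B0_pos hc h0
      have h2 := prox_ascent_contraction hc hn hA h0 h1 t.w t.u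
      simp only
      rw [e1] at h2 ⊢
      calc _ = (1 + c.B0 ηh) ^ S
            * ((1 + c.B0 ηh) * ‖prox ηh P.h (t.u + ηh • P.gradUbar s.w t.u) - P.uStar s.w‖) := by
            ring
        _ ≤ (1 + c.B0 ηh) ^ S * ‖t.u - P.uStar s.w‖ := by gcongr
        _ ≤ _ := h

/-- The structure of one epoch. -/
theorem epoch_spec (hc : c.Valid) (hn : 0 < n) (hA : Assumptions P c) {ηh : ℝ}
    (h0 : 0 < ηh) (h1 : ηh ≤ 2 / (c.Lu + c.muH)) (η : ℝ) (S : ℕ) (σ : Equiv.Perm (Fin n))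
    (s : State p q) :
    (1 + S * c.B0 ηh) * ‖(P.epoch η ηh S σ s).u - P.uStar s.w‖ ≤ ‖s.u - P.uStar s.w‖ ∧
    (∃ x : ℕ → Euc p, x 0 = s.w ∧
      (∀ i : Fin n, x (i + 1)
        = x i - (η / (n : ℝ)) • P.gradW (σ i) (x i) (P.epoch η ηh S σ s).u) ∧
      (P.epoch η ηh S σ s).w = prox η P.f (x n)) ∧
    (P.epoch η ηh S σ s).evalW = s.evalW + n ∧
    (P.epoch η ηh S σ s).evalU = s.evalU + S * n ∧
    (P.epoch η ηh S σ s).evalProxF = s.evalProxF + 1 ∧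
    (P.epoch η ηh S σ s).evalProxH = s.evalProxH + S := by
  obtain ⟨e1, e2, e3, e4, e5, h⟩ := iterate_ascentStep hc hn hA h0 h1 s S
  set s₁ := (P.ascentStep ηh)^[S] s with hs₁
  obtain ⟨y, hy0, hy, hfold⟩ := exists_seq_foldl_finRange (P.descentStep η σ) s₁
  have hinv : ∀ k ≤ n, (y k).u = s₁.u ∧ (y k).evalW = s₁.evalW + k ∧ (y k).evalU = s₁.evalU ∧
      (y k).evalProxF = s₁.evalProxF ∧ (y k).evalProxH = s₁.evalProxH := by
    intro k
    induction k with
    | zero => intro _; simp [hy0]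
    | succ k ih =>
      intro hk
      have h2 := hy ⟨k, hk⟩
      simp only at h2
      obtain ⟨a1, a2, a3, a4, a5⟩ := ih (by omega)
      rw [h2]
      simp only [Problem.descentStep]
      refine ⟨a1, by rw [a2]; ring, a3, a4, a5⟩
  have hep : P.epoch η ηh S σ s = { y n with
      w := prox η P.f (y n).w
      evalProxF := (y n).evalProxF + 1 } := by
    simp only [Problem.epoch, ← hs₁, hfold]
  obtain ⟨a1, a2, a3, a4, a5⟩ := hinv n le_rfl
  have hB := B0_pos hc h0
  refine ⟨?_, ⟨fun k => (y k).w, ?_, fun i => ?_, ?_⟩, ?_, ?_, ?_, ?_⟩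
  · rw [hep]
    simp only [a1]
    refine le_trans ?_ h
    gcongr
    -- Bernoulli's inequality: growth linear in `S` is all that the choice of `S` requires.
    exact one_add_mul_le_pow (by linarith) S
  · simp only [hy0, e1]
  · simp only [hy i, hep, a1]
    simp only [Problem.descentStep, (hinv i i.2.le).1]
  · rw [hep]
  · rw [hep]; simp only [a2, e2]
  · rw [hep]; simp only [a3, e3]
  · rw [hep]; simp only [a4, e4]
  · rw [hep]; simp only [a5, e5]

end Ascent

/-! ### Drift of the shuffled inner loop. -/

theorem norm_add_three_sq_le {E : Type*} [NormedAddCommGroup E] (x y z : E) :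
    ‖x + y + z‖ ^ 2 ≤ 5 / 3 * ‖x‖ ^ 2 + 5 * ‖y‖ ^ 2 + 5 * ‖z‖ ^ 2 := by
  have h : ‖x + y + z‖ ^ 2 ≤ (‖x‖ + ‖y‖ + ‖z‖) ^ 2 := by gcongr; exact norm_add₃_le
  -- Weighted Cauchy–Schwarz with weights `3/5, 1/5, 1/5`. The first term is favoured because it
  -- later contains the drift itself.
  nlinarith [sq_nonneg (‖x‖ - 3 * ‖y‖), sq_nonneg (‖x‖ - 3 * ‖z‖), sq_nonneg (‖y‖ - ‖z‖)]

theorem sq_norm_sum_range_le {E : Type*} [NormedAddCommGroup E] {n k : ℕ} (hk : k ≤ n)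
    (a : ℕ → E) :
    ‖∑ j ∈ Finset.range k, a j‖ ^ 2 ≤ k * ∑ j ∈ Finset.range n, ‖a j‖ ^ 2 := by
  have h1 : ‖∑ j ∈ Finset.range k, a j‖ ^ 2 ≤ (∑ j ∈ Finset.range k, ‖a j‖) ^ 2 := by
    gcongr; exact norm_sum_le _ _
  have h2 : (∑ j ∈ Finset.range k, ‖a j‖) ^ 2 ≤ k * ∑ j ∈ Finset.range k, ‖a j‖ ^ 2 := by
    simpa using sq_sum_le_card_mul_sum_sq (s := Finset.range k) (f := fun i => ‖a i‖)
  have h3 : ∑ j ∈ Finset.range k, ‖a j‖ ^ 2 ≤ ∑ j ∈ Finset.range n, ‖a j‖ ^ 2 :=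
    Finset.sum_le_sum_of_subset_of_nonneg (Finset.range_mono hk) fun _ _ _ => sq_nonneg _
  calc _ ≤ (k : ℝ) * ∑ j ∈ Finset.range k, ‖a j‖ ^ 2 := h1.trans h2
    _ ≤ _ := by gcongr

theorem sum_range_cast_le (n : ℕ) : ∑ k ∈ Finset.range n, (k : ℝ) ≤ (n : ℝ) ^ 2 / 2 := by
  induction n with
  | zero => simp
  | succ n ih => rw [Finset.sum_range_succ]; push_cast; linarith

theorem sum_range_cast_sq_le (n : ℕ) : ∑ k ∈ Finset.range n, (k : ℝ) ^ 2 ≤ (n : ℝ) ^ 3 / 3 := by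
  induction n with
  | zero => simp
  | succ n ih =>
    rw [Finset.sum_range_succ]; push_cast
    have : (0 : ℝ) ≤ n := n.cast_nonneg
    nlinarith

/-- Drift of the inner loop of a shuffling method. -/
theorem sum_sq_drift_le {E : Type*} [NormedAddCommGroup E] [NormedSpace ℝ E] {n : ℕ} (hn : 0 < n)
    {η : ℝ} {x a b : ℕ → E} {e : E}
    (hx : ∀ i < n, x (i + 1) = x i - (η / (n : ℝ)) • (a i + b i + e)) :
    ∑ k ∈ Finset.range n, ‖x k - x 0‖ ^ 2
      ≤ η ^ 2 * (5 / 6 * ∑ j ∈ Finset.range n, ‖a j‖ ^ 2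
        + 5 / 2 * ∑ j ∈ Finset.range n, ‖b j‖ ^ 2 + 5 / 3 * (n * ‖e‖ ^ 2)) := by
  have hn' : (0 : ℝ) < n := by exact_mod_cast hn
  have hsum : ∀ k ≤ n, x k - x 0 = -((η / (n : ℝ)) • (∑ j ∈ Finset.range k, a j
      + ∑ j ∈ Finset.range k, b j + (k : ℝ) • e)) := by
    intro k
    induction k with
    | zero => simp
    | succ k ih =>
      intro hk
      rw [hx k hk, Finset.sum_range_succ, Finset.sum_range_succ]
      have h1 := ih (by omega)
      have : x k = x 0 + -((η / (n : ℝ)) • (∑ j ∈ Finset.range k, a j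
        + ∑ j ∈ Finset.range k, b j + (k : ℝ) • e)) := by rw [← h1]; abel
      rw [this]
      push_cast
      module
  set A := ∑ j ∈ Finset.range n, ‖a j‖ ^ 2
  set B := ∑ j ∈ Finset.range n, ‖b j‖ ^ 2
  have hA : 0 ≤ A := Finset.sum_nonneg fun _ _ => sq_nonneg _
  have hB : 0 ≤ B := Finset.sum_nonneg fun _ _ => sq_nonneg _
  have hk : ∀ k ∈ Finset.range n, ‖x k - x 0‖ ^ 2
      ≤ (η / n) ^ 2 * ((5 / 3 * A + 5 * B) * k + 5 * ‖e‖ ^ 2 * (k : ℝ) ^ 2) := by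
    intro k hk
    have hkn := (Finset.mem_range.1 hk).le
    rw [hsum k hkn, norm_neg, norm_smul, mul_pow, Real.norm_eq_abs, sq_abs]
    have h1 := norm_add_three_sq_le (∑ j ∈ Finset.range k, a j) (∑ j ∈ Finset.range k, b j)
      ((k : ℝ) • e)
    have h2 := sq_norm_sum_range_le hkn a
    have h3 := sq_norm_sum_range_le hkn b
    have h4 : ‖(k : ℝ) • e‖ ^ 2 = (k : ℝ) ^ 2 * ‖e‖ ^ 2 := by
      rw [norm_smul, mul_pow, Real.norm_eq_abs, sq_abs]
    rw [h4] at h1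
    refine mul_le_mul_of_nonneg_left ?_ (sq_nonneg _)
    linarith
  refine (Finset.sum_le_sum hk).trans ?_
  rw [← Finset.mul_sum, Finset.sum_add_distrib, ← Finset.mul_sum, ← Finset.mul_sum]
  calc (η / n) ^ 2 * ((5 / 3 * A + 5 * B) * ∑ k ∈ Finset.range n, (k : ℝ)
        + 5 * ‖e‖ ^ 2 * ∑ k ∈ Finset.range n, (k : ℝ) ^ 2)
      ≤ (η / n) ^ 2 * ((5 / 3 * A + 5 * B) * ((n : ℝ) ^ 2 / 2)
        + 5 * ‖e‖ ^ 2 * ((n : ℝ) ^ 3 / 3)) := by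
        gcongr
        · exact sum_range_cast_le n
        · exact sum_range_cast_sq_le n
    _ = _ := by field_simp; ring

/-! ### One epoch as an inexact proximal gradient step. -/

section Descent

variable {n p q : ℕ} {P : Problem n p q} {c : Consts}

/-- The error of the averaged shuffling direction. -/
theorem shuffling_error (hn : 0 < n) (hA : Assumptions P c) (hc : c.Valid) {η : ℝ}
    (hη : (c.Lw * η) ^ 2 ≤ 1 / 16) (σ : Equiv.Perm (Fin n)) {x : ℕ → Euc p} (u : Euc q)
    (hx : ∀ i : Fin n, x (i + 1) = x i - (η / (n : ℝ)) • P.gradW (σ i) (x i) u) :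
    ∃ g, x n = x 0 - η • g ∧ ‖g - P.gradPhi (x 0)‖ ^ 2
      ≤ (1 + (c.Lw * η) ^ 2) * (c.Lu * ‖u - P.uStar (x 0)‖) ^ 2
        + (c.Lw * η) ^ 2 * (3 * (c.Thw * ‖P.gradPhi (x 0)‖ ^ 2 + c.sigw ^ 2)
          + 2 * ‖P.gradPhi (x 0)‖ ^ 2) := by
  have hn' : (0 : ℝ) < n := by exact_mod_cast hn
  rw [gradPhi_eq hc hn hA]
  set w := x 0 with hw
  set us := P.uStar w with hus
  set e := P.gradWbar w us with he
  -- Each inner gradient is split around the reference point `(w, u₀*(w))`: `a` is the Lipschitz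
  -- deviation, `b` the deviation from the mean, and `e = ∇Φ₀(w)`. The value `0` beyond `n` never
  -- matters.
  set a : ℕ → Euc p := fun i => if h : i < n then
    P.gradW (σ ⟨i, h⟩) (x i) u - P.gradW (σ ⟨i, h⟩) w us else 0 with ha
  set b : ℕ → Euc p := fun i => if h : i < n then P.gradW (σ ⟨i, h⟩) w us - e else 0 with hb
  have hab : ∀ i : Fin n, a i + b i + e = P.gradW (σ i) (x i) u := by
    intro i; simp [ha, hb]
  have hx' : ∀ i < n, x (i + 1) = x i - (η / (n : ℝ)) • (a i + b i + e) := fun i hi => by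
    rw [hab ⟨i, hi⟩]; exact hx ⟨i, hi⟩
  have hdrift := sum_sq_drift_le hn hx'
  rw [← hw] at hdrift
  set A := ∑ k ∈ Finset.range n, ‖x k - w‖ ^ 2 with hAdef
  set d := c.Lu * ‖u - us‖ with hd
  have hasum : ∑ j ∈ Finset.range n, ‖a j‖ ^ 2 ≤ c.Lw ^ 2 * A + n * d ^ 2 := by
    have : ∀ j ∈ Finset.range n, ‖a j‖ ^ 2 ≤ c.Lw ^ 2 * ‖x j - w‖ ^ 2 + d ^ 2 := by
      intro j hj
      have hj' := Finset.mem_range.1 hj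
      have h := hA.H_lip (σ ⟨j, hj'⟩) (x j) u w us
      simp only [ha, hj', dif_pos]
      rw [hd, mul_pow]
      linarith [sq_nonneg ‖P.gradU (σ ⟨j, hj'⟩) (x j) u - P.gradU (σ ⟨j, hj'⟩) w us‖]
    refine (Finset.sum_le_sum this).trans (le_of_eq ?_)
    rw [Finset.sum_add_distrib, ← Finset.mul_sum]
    simp [hAdef]
  have hbsum : ∑ j ∈ Finset.range n, ‖b j‖ ^ 2 ≤ n * (c.Thw * ‖e‖ ^ 2 + c.sigw ^ 2) := by
    have h1 : ∑ j ∈ Finset.range n, ‖b j‖ ^ 2 = ∑ i, ‖P.gradW i w us - e‖ ^ 2 := by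
      rw [Finset.sum_range, ← Equiv.sum_comp σ (fun i => ‖P.gradW i w us - e‖ ^ 2)]
      refine Finset.sum_congr rfl fun i _ => ?_
      simp [hb]
    have h2 := hA.varW w us
    rw [one_div, inv_mul_le_iff₀ hn'] at h2
    rw [h1]
    exact h2
  -- Solving for `A` costs a factor `96/91`, since `5/6 · 1/16 = 5/96`; the coefficients `5/6, 5/2,
  -- 5/3` then stay below `1, 3, 2`.
  have hA2 : A ≤ η ^ 2 * (n * (d ^ 2 + 3 * (c.Thw * ‖e‖ ^ 2 + c.sigw ^ 2) + 2 * ‖e‖ ^ 2)) := by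
    have hA0 : 0 ≤ A := Finset.sum_nonneg fun _ _ => sq_nonneg _
    have h1 : A ≤ η ^ 2 * (5 / 6 * (c.Lw ^ 2 * A + n * d ^ 2)
        + 5 / 2 * (n * (c.Thw * ‖e‖ ^ 2 + c.sigw ^ 2)) + 5 / 3 * (n * ‖e‖ ^ 2)) := by
      refine hdrift.trans ?_
      gcongr
    have h2 : η ^ 2 * (c.Lw ^ 2 * A) ≤ 1 / 16 * A := by
      calc η ^ 2 * (c.Lw ^ 2 * A) = (c.Lw * η) ^ 2 * A := by ring
        _ ≤ 1 / 16 * A := by gcongr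
    have h3 : 0 ≤ η ^ 2 * (n * d ^ 2) := by positivity
    have h4 : 0 ≤ η ^ 2 * (n * (c.Thw * ‖e‖ ^ 2 + c.sigw ^ 2)) := by
      have := hc.Thw_nonneg
      positivity
    have h5 : 0 ≤ η ^ 2 * (n * ‖e‖ ^ 2) := by positivity
    linarith
  -- The permutation visits every component once, so the `b` terms enter only through the drift.
  have hbz : ∑ i : Fin n, b i = 0 := by
    have h1 : ∑ i : Fin n, b i = ∑ i, (P.gradW i w us - e) := by
      rw [← Equiv.sum_comp σ (fun i => P.gradW i w us - e)]
      refine Finset.sum_congr rfl fun i _ => ?_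
      simp [hb]
    rw [h1, Finset.sum_sub_distrib, he, gradWbar_eq hA, Finset.sum_const, Finset.card_univ,
      Fintype.card_fin, ← Nat.cast_smul_eq_nsmul ℝ, smul_smul, mul_one_div_cancel hn'.ne',
      one_smul, sub_self]
  refine ⟨(1 / (n : ℝ)) • ∑ i : Fin n, (a i + b i + e), ?_, ?_⟩
  · have hsum : ∀ k ≤ n, x k = w - (η / (n : ℝ)) • ∑ j ∈ Finset.range k, (a j + b j + e) := by
      intro k
      induction k with
      | zero => simp [hw]
      | succ k ih =>
        intro hk
        rw [hx' k hk, Finset.sum_range_succ, ih (by omega)]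
        module
    rw [hsum n le_rfl, Finset.sum_range, smul_smul, mul_one_div]
  · have h1 : (1 / (n : ℝ)) • ∑ i : Fin n, (a i + b i + e) - e
        = (1 / (n : ℝ)) • ∑ i : Fin n, a i := by
      rw [Finset.sum_add_distrib, Finset.sum_add_distrib, hbz, add_zero, Finset.sum_const,
        Finset.card_univ, Fintype.card_fin, ← Nat.cast_smul_eq_nsmul ℝ, smul_add, smul_smul,
        one_div_mul_cancel hn'.ne', one_smul, add_sub_cancel_right]
    rw [h1]
    have h2 := sq_norm_mean_le hn (fun i : Fin n => a i)
    rw [Finset.sum_range] at hasum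
    refine h2.trans ?_
    rw [one_div, inv_mul_le_iff₀ hn']
    refine hasum.trans ?_
    have h3 := mul_le_mul_of_nonneg_left hA2 (sq_nonneg c.Lw)
    refine (add_le_add_left h3 _).trans (le_of_eq ?_)
    ring

/-- `Ψ₀` as a real-valued function on `dom f`. -/
def Problem.PsiR (P : Problem n p q) (w : Euc p) : ℝ := (P.Phi w).toReal + (P.f w).toReal

/-- Descent for an inexact proximal gradient step. -/
theorem inexact_prox_descent (hc : c.Valid) (hn : 0 < n) (hA : Assumptions P c) {η : ℝ}
    (hη : 0 < η) {w : Euc p} (hw : w ∈ effDom P.f) (g : Euc p) :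
    ∃ X Y : ℝ, ‖prox η P.f (w - η • g) - w‖ = η * X ∧
      (Y - X) ^ 2 ≤ ‖P.gradMap η w‖ ^ 2 ∧
      P.PsiR (prox η P.f (w - η • g)) ≤ P.PsiR w + η / 2 * (2 * (‖g - P.gradPhi w‖ * Y)
        - Y ^ 2 - (1 - (c.Lw + c.Lu * c.lipU) * η) * X ^ 2 - ‖P.gradMap η w‖ ^ 2) := by
  have hconv : StrongConvexOn (effDom P.f) 0 (fun x => (P.f x).toReal) :=
    strongConvexOn_zero.2 hA.f_pcc.convex
  set D := P.gradPhi w with hD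
  set wp := prox η P.f (w - η • g) with hwp
  set wh := prox η P.f (w - η • D) with hwh
  have hwhd : wh ∈ effDom P.f := (prox_spec hA.f_pcc le_rfl hconv hη _).1
  -- The inexact point is tested against the exact prox point, and that one against `w`; the
  -- intermediate value of `f` cancels.
  have h1 := prox_variational hA.f_pcc le_rfl hconv hη (w - η • g) hwhd
  have h2 := prox_variational hA.f_pcc le_rfl hconv hη (w - η • D) hw
  have h3 := Phi_descent hc hn hA w wp
  rw [← hwp] at h1
  rw [← hwh] at h2
  set G := P.gradMap η w with hG
  set X : Euc p := η⁻¹ • (w - wp) with hX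
  have eX : w - wp = η • X := by rw [hX, smul_inv_smul₀ hη.ne']
  have eG : w - wh = η • G := by rw [hG, Problem.gradMap, smul_inv_smul₀ hη.ne']
  have e1 : w - η • g - wp = η • (X - g) := by rw [smul_sub, ← eX]; abel
  have e2 : w - η • D - wh = η • (G - D) := by rw [smul_sub, ← eG]; abel
  have e3 : wh - wp = η • (X - G) := by rw [smul_sub, ← eX, ← eG]; abel
  have e4 : wp - w = -(η • X) := by rw [← eX]; abel
  rw [e1, e3, inner_smul_left, inner_smul_right] at h1
  rw [e2, eG, inner_smul_left, inner_smul_right] at h2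
  rw [e4, inner_neg_right, inner_smul_right, norm_neg, norm_smul, mul_pow, Real.norm_eq_abs,
    sq_abs, ← hD] at h3
  simp only [conj_trivial, inv_mul_cancel_left₀ hη.ne', zero_div, zero_mul, add_zero] at h1 h2
  refine ⟨‖X‖, ‖X - G‖, ?_, ?_, ?_⟩
  · rw [e4, norm_neg, norm_smul, Real.norm_eq_abs, abs_of_pos hη]
  · have := abs_norm_sub_norm_le (X - G) X
    rw [sub_sub_cancel_left, norm_neg] at this
    exact sq_le_sq.2 (this.trans_eq (abs_of_nonneg (norm_nonneg _)).symm)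
  · have h4 : inner ℝ (g - D) (X - G) ≤ ‖g - D‖ * ‖X - G‖ := real_inner_le_norm _ _
    -- Polarization turns `‖X‖² - ⟪X, G⟫ + ‖G‖²` into half of `‖X‖² + ‖G‖² + ‖X - G‖²`, so all three
    -- squares are kept as descent.
    have h5 : ‖X - G‖ ^ 2 = ‖X‖ ^ 2 - 2 * inner ℝ X G + ‖G‖ ^ 2 := norm_sub_sq_real X G
    simp only [inner_sub_left, inner_sub_right, real_inner_self_eq_norm_sq] at h1 h2 h4
    unfold Problem.PsiR
    rw [real_inner_comm] at h5
    have h6 := mul_le_mul_of_nonneg_left h4 hη.le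
    rw [h5]
    rw [real_inner_comm] at h5
    have h7 : inner ℝ G X = inner ℝ X G := real_inner_comm _ _
    rw [h7]
    linarith

end Descent

/-! ### The scalar inequality for the Lyapunov function. -/

theorem one_le_curvature_product {l k : ℝ} (hl : 0 ≤ l) (hk : 0 ≤ k) (hlk : l + k ≤ 1 / 4) :
    1 ≤ (11 / 12 - l - 3 / 2 * k) * (19 / 15 + 64 / 15 * l ^ 2 + 25 / 8 * k) := by
  -- The tangent of `l²` at `l = 1/5` makes the second factor affine in `l` and `k`.
  have h1 : 2 / 5 * l - 1 / 25 ≤ l ^ 2 := by nlinarith [sq_nonneg (l - 1 / 5)]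
  have h2 : 0 ≤ 11 / 12 - l - 3 / 2 * k := by linarith
  have h3 : (11 / 12 - l - 3 / 2 * k) * (19 / 15 + 64 / 15 * (2 / 5 * l - 1 / 25) + 25 / 8 * k)
      ≤ (11 / 12 - l - 3 / 2 * k) * (19 / 15 + 64 / 15 * l ^ 2 + 25 / 8 * k) := by gcongr
  refine le_trans ?_ h3
  have h4 : 0 ≤ 1 / 4 - l - k := by linarith
  nlinarith [mul_nonneg hl hk, mul_nonneg hl h4, mul_nonneg hk h4]

/-- The scalar inequality behind the Lyapunov function of the method. -/
theorem lyapunov_scalar {ω l k K M d d₀ X Y E Z N : ℝ} (hω : 0 < ω) (hl : 0 ≤ l) (hk : 0 ≤ k)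
    (hkK : k ≤ K) (hlk : l + k ≤ 1 / 4) (hτ : ω * k ≤ 1 / 2)
    (hM : ω * M = 1 + ω ^ 2 * K ^ 2 + 2 * l ^ 2) (hd : 0 ≤ d)
    (hd₀ : (1 + M / 2) * d ≤ d₀) (hE : E ^ 2 ≤ (1 + l ^ 2) * d ^ 2 + N) (hN : 0 ≤ N)
    (hZ : (Y - X) ^ 2 ≤ Z ^ 2) :
    ω * (d + k * X) ^ 2 + (2 * (E * Y) - Y ^ 2 - (1 - (l + k)) * X ^ 2 - Z ^ 2)
      ≤ ω * d₀ ^ 2 + N - Z ^ 2 / 2 := by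
  set τ := ω * k with hτdef
  have hτ0 : 0 ≤ τ := mul_nonneg hω.le hk
  -- Half of `-Z²` is traded for `-(Y - X)²/2`. Maximizing over `Y` and splitting the product `E X`
  -- gives the coefficient `14/15 < 1` of `E²`, whose slack helps to pay for the cross term.
  have h1 : 2 * (E * Y) - Y ^ 2 - 1 / 2 * (Y - X) ^ 2 ≤ 14 / 15 * E ^ 2 + X ^ 2 / 12 := by
    nlinarith [sq_nonneg (3 * Y - 2 * E - X), sq_nonneg (4 * E - 5 * X)]
  have hm : 1 + τ ^ 2 + 2 * l ^ 2 ≤ ω * M := by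
    rw [hM, hτdef, mul_pow]
    gcongr
  have hM0 : 0 < M := by
    have : 0 < ω * M := lt_of_lt_of_le (by positivity) hm
    exact pos_of_mul_pos_right this hω.le
  have hquad : 25 / 16 * (τ * k) ≤ ω * M ^ 2 / 4 := by
    -- For `τ ≤ 1/2`, `1 + τ² - 5τ/2 = (1/2 - τ)(2 - τ) ≥ 0`.
    have h25 : 5 / 2 * τ ≤ ω * M := by nlinarith [sq_nonneg l]
    have h26 : (5 / 2 * τ) ^ 2 ≤ (ω * M) ^ 2 := by gcongr
    have h27 : ω * (25 / 16 * (τ * k)) ≤ ω * (ω * M ^ 2 / 4) := by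
      have e1 : ω * (25 / 16 * (τ * k)) = (5 / 2 * τ) ^ 2 / 4 := by rw [hτdef]; ring
      have e2 : ω * (ω * M ^ 2 / 4) = (ω * M) ^ 2 / 4 := by ring
      rw [e1, e2]
      linarith
    exact le_of_mul_le_mul_left h27 hω
  have hd₀2 : (ω + 1 + τ ^ 2 + 2 * l ^ 2 + 25 / 16 * (τ * k)) * d ^ 2 ≤ ω * d₀ ^ 2 := by
    calc (ω + 1 + τ ^ 2 + 2 * l ^ 2 + 25 / 16 * (τ * k)) * d ^ 2
        ≤ (ω + ω * M + ω * M ^ 2 / 4) * d ^ 2 := by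
          refine mul_le_mul_of_nonneg_right ?_ (sq_nonneg _)
          linarith
      _ = ω * ((1 + M / 2) * d) ^ 2 := by ring
      _ ≤ ω * d₀ ^ 2 := by gcongr
  -- `a` and `b` are the coefficients of `X²` and `d²` left over after all other terms; the cross
  -- term `2 τ d X` is absorbed exactly when `τ² ≤ a b`.
  set a := 11 / 12 - l - k - τ * k with ha
  set b := 1 / 15 + τ ^ 2 + 16 / 15 * l ^ 2 + 25 / 16 * (τ * k) with hb
  have ha' : 11 / 12 - l - 3 / 2 * k ≤ a := by
    have : τ * k ≤ 1 / 2 * k := by gcongr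
    linarith
  have hτ2 : τ ^ 2 ≤ 1 / 4 := by nlinarith
  have hb' : τ ^ 2 * (19 / 15 + 64 / 15 * l ^ 2 + 25 / 8 * k) ≤ b := by
    have h2 : τ ^ 2 * l ^ 2 ≤ 1 / 4 * l ^ 2 := by gcongr
    have h3 : τ ^ 2 * k ≤ 1 / 2 * (τ * k) := by
      have : τ * (τ * k) ≤ 1 / 2 * (τ * k) := by gcongr
      linarith
    linarith
  have ha0 : 0 < a := by linarith
  have hab : τ ^ 2 ≤ a * b := by
    have h2 := one_le_curvature_product hl hk hlk
    calc τ ^ 2 ≤ τ ^ 2 * ((11 / 12 - l - 3 / 2 * k) * (19 / 15 + 64 / 15 * l ^ 2 + 25 / 8 * k)) :=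
          le_mul_of_one_le_right (sq_nonneg _) h2
      _ = (11 / 12 - l - 3 / 2 * k) * (τ ^ 2 * (19 / 15 + 64 / 15 * l ^ 2 + 25 / 8 * k)) := by ring
      _ ≤ a * b := by
          apply mul_le_mul ha' hb' (by positivity) ha0.le
  have hcross : 2 * τ * d * X ≤ b * d ^ 2 + a * X ^ 2 := by
    have h2 : a * (2 * τ * d * X) ≤ a * (b * d ^ 2 + a * X ^ 2) := by
      have h3 := sq_nonneg (a * X - τ * d)
      have h4 := mul_le_mul_of_nonneg_right hab (sq_nonneg d)
      have e : a * (b * d ^ 2 + a * X ^ 2) - a * (2 * τ * d * X)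
          = (a * X - τ * d) ^ 2 + (a * b * d ^ 2 - τ ^ 2 * d ^ 2) := by ring
      linarith
    exact le_of_mul_le_mul_left h2 ha0
  have e : ω * (d + k * X) ^ 2 = ω * d ^ 2 + 2 * τ * d * X + τ * k * X ^ 2 := by
    rw [hτdef]; ring
  rw [e]
  simp only [ha, hb] at hcross
  clear_value τ
  linarith

/-! ### Consequences of the step size conditions. -/

section Steps

variable {c : Consts}

theorem kappa_pos (hc : c.Valid) : 0 < c.kappa := div_pos hc.Lu_pos hc.mu_pos

theorem LPhi_pos (hc : c.Valid) : 0 < c.LPhi :=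
  mul_pos (by linarith [kappa_pos hc]) hc.Lw_pos

theorem C0_pos (hc : c.Valid) : 0 < c.C0 := by
  have h1 := hc.Lam0_ge
  have h2 := hc.Lw_pos
  have h3 := hc.Thw_nonneg
  have : 0 < c.Lam0 := by linarith
  unfold Consts.C0
  positivity

theorem C0_mul_sq_le (hc : c.Valid) {η : ℝ} (h0 : 0 < η)
    (h : η ≤ 1 / (2 * Real.sqrt c.C0)) : c.C0 * η ^ 2 ≤ 1 / 4 := by
  have hs := Real.sqrt_pos.2 (C0_pos hc)
  rw [le_div_iff₀ (by positivity)] at h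
  have h1 : (Real.sqrt c.C0 * η) ^ 2 ≤ (1 / 2) ^ 2 := by
    gcongr
    linarith
  rw [mul_pow, Real.sq_sqrt (C0_pos hc).le] at h1
  linarith

theorem LPhi_mul_le (hc : c.Valid) {η : ℝ} (h : η ≤ 1 / (4 * c.LPhi)) :
    c.LPhi * η ≤ 1 / 4 := by
  have := LPhi_pos hc
  rw [le_div_iff₀ (by positivity)] at h
  linarith

theorem StepSize.spec (hc : c.Valid) {ω η : ℝ} (hω : 0 < ω) (h : c.StepSize ω η) :
    0 < η ∧ c.C0 * η ^ 2 ≤ 1 / 4 ∧ c.LPhi * η ≤ 1 / 4 ∧ ω * (c.Lu * c.kappa * η) ≤ 1 / 2 := by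
  obtain ⟨h0, h1⟩ := h
  rw [le_min_iff, le_min_iff] at h1
  obtain ⟨⟨h1, h2⟩, h3⟩ := h1
  refine ⟨h0, C0_mul_sq_le hc h0 h1, LPhi_mul_le hc h2, ?_⟩
  have := kappa_pos hc
  have := hc.Lu_pos
  rw [le_div_iff₀ (by positivity)] at h3
  linarith

theorem Mom_pos {ω : ℝ} (hω : 0 < ω) (η : ℝ) : 0 < c.Mom ω η := by
  unfold Consts.Mom
  positivity

theorem Mom_le_numSteps (hc : c.Valid) {ηh : ℝ} (h0 : 0 < ηh) (ω η : ℝ) :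
    c.Mom ω η / 2 ≤ c.numSteps ω η ηh * c.B0 ηh := by
  have h := Nat.le_ceil (c.Mom ω η / (2 * c.B0 ηh))
  have hB := B0_pos hc h0
  rw [div_le_iff₀ (by positivity)] at h
  unfold Consts.numSteps
  linarith

end Steps

/-! ### Descent of the Lyapunov function and the averaged estimate. -/

section Convergence

variable {n p q : ℕ} {P : Problem n p q} {c : Consts}

/-- One epoch decreases the Lyapunov function. -/
theorem epoch_descent (hc : c.Valid) (hn : 0 < n) (hA : Assumptions P c) {ηh : ℝ}
    (h0 : 0 < ηh) (h1 : ηh ≤ 2 / (c.Lu + c.muH)) {ω η : ℝ} (hω : 0 < ω) (hη : c.StepSize ω η)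
    (hG : GradMapBound P c η) (σ : Equiv.Perm (Fin n)) {s s' : State p q}
    (hs : s.w ∈ effDom P.f) (hs' : s' = P.epoch η ηh (c.numSteps ω η ηh) σ s) :
    s'.w ∈ effDom P.f ∧
    η / 8 * ‖P.gradMap η s.w‖ ^ 2
      + (P.PsiR s'.w + ω * c.Lu ^ 2 * η / 2 * ‖s'.u - P.uStar s'.w‖ ^ 2)
      ≤ P.PsiR s.w + ω * c.Lu ^ 2 * η / 2 * ‖s.u - P.uStar s.w‖ ^ 2 + c.Cw * η ^ 3 := by
  obtain ⟨hη0, hC0, hLP, hωk⟩ := StepSize.spec hc hω hη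
  obtain ⟨hcontr, ⟨x, hx0, hx, hw'⟩, -⟩ :=
    epoch_spec hc hn hA h0 h1 η (c.numSteps ω η ηh) σ s
  rw [← hs'] at hcontr hx hw'
  have hLw := hc.Lw_pos
  have hLu := hc.Lu_pos
  have hkap := kappa_pos hc
  have hlip := lipU_pos hc
  set l := c.Lw * η with hl
  set k := c.Lu * c.lipU * η with hk
  have hl0 : 0 ≤ l := by positivity
  have hk0 : 0 ≤ k := by positivity
  have hkK : k ≤ c.Lu * c.kappa * η := by
    have := lipU_le_kappa hc
    rw [hk]; gcongr
  have hlk : l + k ≤ 1 / 4 := by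
    refine le_trans ?_ hLP
    have : k ≤ c.kappa * c.Lw * η := by
      have := Lu_mul_lipU_le hc
      rw [hk]; gcongr
    unfold Consts.LPhi
    rw [hl]
    linarith
  have hl16 : l ^ 2 ≤ 1 / 16 := by nlinarith
  obtain ⟨g, hxn, herr⟩ := shuffling_error hn hA hc hl16 σ s'.u hx
  rw [hx0] at hxn herr
  rw [hxn] at hw'
  obtain ⟨X, Y, hXn, hYX, hdesc⟩ := inexact_prox_descent hc hn hA hη0 hs g
  rw [← hw'] at hXn hdesc
  have hdomf : s'.w ∈ effDom P.f := by
    rw [hw']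
    exact (prox_spec hA.f_pcc le_rfl (strongConvexOn_zero.2 hA.f_pcc.convex) hη0 _).1
  refine ⟨hdomf, ?_⟩
  set N := l ^ 2 * (3 * (c.Thw * ‖P.gradPhi s.w‖ ^ 2 + c.sigw ^ 2) + 2 * ‖P.gradPhi s.w‖ ^ 2)
    with hN
  have hTh := hc.Thw_nonneg
  have hL1 := hc.Lam1_nonneg
  have hN0 : 0 ≤ N := by positivity
  -- The growth bound on `∇Φ₀` and `C₀ η² ≤ 1/4` let the drift consume half of the available
  -- `‖𝒢_η‖²/2`; the remaining quarter, times `η/2`, is the descent `η/8`.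
  have hNle : N ≤ ‖P.gradMap η s.w‖ ^ 2 / 4 + 2 * c.Cw * η ^ 2 := by
    have hg := hG s.w (by
      change P.Phi s.w < ⊤
      rw [Phi_eq hc hn hA]; exact EReal.coe_lt_top _)
    set Z2 := ‖P.gradMap η s.w‖ ^ 2
    have hL0 : 0 ≤ c.Lam0 := by linarith [hc.Lam0_ge]
    have hZ2 : 0 ≤ Z2 := sq_nonneg _
    calc N = l ^ 2 * ((3 * c.Thw + 2) * ‖P.gradPhi s.w‖ ^ 2 + 3 * c.sigw ^ 2) := by rw [hN]; ring
      _ ≤ l ^ 2 * ((3 * c.Thw + 2) * (c.Lam0 * Z2 + c.Lam1) + 3 * c.sigw ^ 2) := by gcongr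
      _ ≤ l ^ 2 * ((2 * (3 * c.Thw + 1)) * (c.Lam0 * Z2 + c.Lam1) + 2 * (3 * c.sigw ^ 2)) := by
          have h4 : 3 * c.Thw + 2 ≤ 2 * (3 * c.Thw + 1) := by linarith
          have h5 : 3 * c.sigw ^ 2 ≤ 2 * (3 * c.sigw ^ 2) := by linarith [sq_nonneg c.sigw]
          gcongr
      _ = (c.C0 * η ^ 2) * Z2 + 2 * c.Cw * η ^ 2 := by
          rw [hl]; unfold Consts.C0 Consts.Cw; ring
      _ ≤ 1 / 4 * Z2 + 2 * c.Cw * η ^ 2 := by gcongr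
      _ = _ := by ring
  have hM0 := Mom_pos (c := c) hω η
  have hlyap := lyapunov_scalar (d := c.Lu * ‖s'.u - P.uStar s.w‖)
    (d₀ := c.Lu * ‖s.u - P.uStar s.w‖) (X := X) (Y := Y) (E := ‖g - P.gradPhi s.w‖)
    (Z := ‖P.gradMap η s.w‖) (M := c.Mom ω η) hω hl0 hk0 hkK hlk
    ((mul_le_mul_of_nonneg_left hkK hω.le).trans hωk) (by
      unfold Consts.Mom
      rw [hl]
      field_simp
      ring) (by positivity) (by
      have h2 := Mom_le_numSteps hc h0 ω η
      have h3 : (1 + c.Mom ω η / 2) * ‖s'.u - P.uStar s.w‖ ≤ ‖s.u - P.uStar s.w‖ := by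
        refine le_trans ?_ hcontr
        gcongr
      calc _ = c.Lu * ((1 + c.Mom ω η / 2) * ‖s'.u - P.uStar s.w‖) := by ring
        _ ≤ _ := by gcongr) herr hN0 hYX
  -- The contraction was measured at the old `w`; passing to the new `u₀*` costs `k X` by Lipschitz
  -- continuity.
  have hdist : c.Lu * ‖s'.u - P.uStar s'.w‖ ≤ c.Lu * ‖s'.u - P.uStar s.w‖ + k * X := by
    have h2 : ‖s'.u - P.uStar s'.w‖ ≤ ‖s'.u - P.uStar s.w‖ + ‖P.uStar s.w - P.uStar s'.w‖ := by
      have := norm_add_le (s'.u - P.uStar s.w) (P.uStar s.w - P.uStar s'.w)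
      rwa [sub_add_sub_cancel] at this
    have h3 := uStar_lip hc hn hA s.w s'.w
    rw [norm_sub_rev s.w s'.w, hXn] at h3
    calc _ ≤ c.Lu * (‖s'.u - P.uStar s.w‖ + c.lipU * (η * X)) := by gcongr; linarith
      _ = _ := by rw [hk]; ring
  have hdist2 : ω * (c.Lu * ‖s'.u - P.uStar s'.w‖) ^ 2
      ≤ ω * (c.Lu * ‖s'.u - P.uStar s.w‖ + k * X) ^ 2 := by gcongr
  have hlk' : (c.Lw + c.Lu * c.lipU) * η = l + k := by rw [hl, hk]; ring
  rw [hlk'] at hdesc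
  have hfin : η / 2 * (ω * (c.Lu * ‖s'.u - P.uStar s'.w‖) ^ 2
      + (2 * (‖g - P.gradPhi s.w‖ * Y) - Y ^ 2 - (1 - (l + k)) * X ^ 2
        - ‖P.gradMap η s.w‖ ^ 2))
      ≤ η / 2 * (ω * (c.Lu * ‖s.u - P.uStar s.w‖) ^ 2
        + 2 * c.Cw * η ^ 2 - ‖P.gradMap η s.w‖ ^ 2 / 4) := by
    refine mul_le_mul_of_nonneg_left ?_ (by positivity)
    linarith
  rw [mul_pow, mul_pow] at hfin
  linarith

theorem Psi_eq (hc : c.Valid) (hn : 0 < n) (hA : Assumptions P c) {w : Euc p}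
    (hw : w ∈ effDom P.f) : P.Psi w = ((P.PsiR w : ℝ) : EReal) := by
  unfold Problem.Psi Problem.PsiR
  rw [EReal.coe_add, coe_toReal_of_mem hA.f_pcc.ne_bot hw, Phi_eq hc hn hA, EReal.toReal_coe]

theorem PsiStar_toReal_le (hc : c.Valid) (hn : 0 < n) (hA : Assumptions P c) {w : Euc p}
    (hw : w ∈ effDom P.f) : P.PsiStar.toReal ≤ P.PsiR w := by
  have h1 : P.PsiStar ≤ P.Psi w := iInf_le _ w
  rw [Psi_eq hc hn hA hw] at h1
  -- `Ψ₀* > -∞` is essential here: `toReal` would send `⊥` to the default value `0`.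
  have := EReal.toReal_le_toReal h1 (ne_of_gt hA.bddBelow) (EReal.coe_ne_top _)
  simpa using this

theorem gap_eq (hc : c.Valid) (hn : 0 < n) (hA : Assumptions P c) {w : Euc p}
    (hw : w ∈ effDom P.f) : P.gap w = P.PsiR w - P.PsiStar.toReal := by
  rw [Problem.gap, Psi_eq hc hn hA hw, EReal.toReal_coe]

theorem gap_nonneg (hc : c.Valid) (hn : 0 < n) (hA : Assumptions P c) {w : Euc p}
    (hw : w ∈ effDom P.f) : 0 ≤ P.gap w := by
  rw [gap_eq hc hn hA hw]
  linarith [PsiStar_toReal_le hc hn hA hw]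

theorem avgGradMap_le (hc : c.Valid) (hn : 0 < n) (hA : Assumptions P c) {ηh : ℝ}
    (h0 : 0 < ηh) (h1 : ηh ≤ 2 / (c.Lu + c.muH)) {ω η : ℝ} (hω : 0 < ω) (hη : c.StepSize ω η)
    (hG : GradMapBound P c η) {w₀ : Euc p} (hw₀ : w₀ ∈ effDom P.f) (u₀ : Euc q)
    (π : ℕ → Equiv.Perm (Fin n)) (T : ℕ) :
    P.avgGradMap η (fun t => (P.run η ηh (c.numSteps ω η ηh) π w₀ u₀ t).w) T
      ≤ 4 * (2 * P.gap w₀ + ω * c.Lu ^ 2 * η * ‖u₀ - P.uStar w₀‖ ^ 2) / (η * ((T : ℝ) + 1))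
        + 8 * c.Cw * η ^ 2 := by
  have hη0 := hη.1
  set r := P.run η ηh (c.numSteps ω η ηh) π w₀ u₀ with hr
  have key : ∀ t, (r t).w ∈ effDom P.f ∧
      η / 8 * ∑ j ∈ Finset.range t, ‖P.gradMap η (r j).w‖ ^ 2
        + (P.PsiR (r t).w + ω * c.Lu ^ 2 * η / 2 * ‖(r t).u - P.uStar (r t).w‖ ^ 2)
        ≤ P.PsiR w₀ + ω * c.Lu ^ 2 * η / 2 * ‖u₀ - P.uStar w₀‖ ^ 2 + t * (c.Cw * η ^ 3) := by
    intro t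
    induction t with
    | zero => simp [hr, Problem.run, hw₀]
    | succ t ih =>
      obtain ⟨h2, h3⟩ := ih
      obtain ⟨h4, h5⟩ := epoch_descent hc hn hA h0 h1 hω hη hG (π t) (s := r t) (s' := r (t + 1))
        h2 rfl
      refine ⟨h4, ?_⟩
      rw [Finset.sum_range_succ]
      push_cast
      linarith
  -- An epoch controls the gradient mapping at its starting point, so the iterates `0, …, T` need
  -- one further epoch, whose end enters only through the lower bound `Ψ₀*`.
  obtain ⟨hdom, hsum⟩ := key (T + 1)
  have hlow := PsiStar_toReal_le hc hn hA hdom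
  have hD : 0 ≤ ω * c.Lu ^ 2 * η / 2 * ‖(r (T + 1)).u - P.uStar (r (T + 1)).w‖ ^ 2 := by
    positivity
  rw [gap_eq hc hn hA hw₀]
  unfold Problem.avgGradMap
  push_cast at hsum
  set Γ := ∑ j ∈ Finset.range (T + 1), ‖P.gradMap η (r j).w‖ ^ 2
  have hT : (0 : ℝ) < (T : ℝ) + 1 := by positivity
  have h2 : η / 8 * Γ ≤ (P.PsiR w₀ - P.PsiStar.toReal)
      + ω * c.Lu ^ 2 * η / 2 * ‖u₀ - P.uStar w₀‖ ^ 2 + (T + 1) * (c.Cw * η ^ 3) := by linarith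
  calc 1 / ((T : ℝ) + 1) * Γ = 8 / (η * ((T : ℝ) + 1)) * (η / 8 * Γ) := by field_simp
    _ ≤ 8 / (η * ((T : ℝ) + 1)) * ((P.PsiR w₀ - P.PsiStar.toReal)
      + ω * c.Lu ^ 2 * η / 2 * ‖u₀ - P.uStar w₀‖ ^ 2 + (T + 1) * (c.Cw * η ^ 3)) := by gcongr
    _ = _ := by field_simp; ring

end Convergence

/-! ### Numbers of ascent steps and admissible accuracies. -/

section Numeric

variable {c : Consts}

/-- For `ω = 1/B₀` the third step size bound is precisely the condition `M_ω(η) ≤ 2 B₀`. -/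
theorem numSteps_one (hc : c.Valid) {ηh : ℝ} (h0 : 0 < ηh) {η : ℝ}
    (hη : c.OneStepSize ηh η) : c.numSteps (1 / c.B0 ηh) η ηh = 1 := by
  obtain ⟨hη0, h⟩ := hη
  have hB := B0_pos hc h0
  have hLw := hc.Lw_pos
  have hLu := hc.Lu_pos
  have hk := kappa_pos hc
  have h3 := h.trans (min_le_right _ _)
  have hq : 0 < c.Lu ^ 2 * c.kappa ^ 2 + 2 * c.B0 ηh ^ 2 * c.Lw ^ 2 := by positivity
  rw [le_div_iff₀ (Real.sqrt_pos.2 hq)] at h3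
  have h4 : (η * Real.sqrt (c.Lu ^ 2 * c.kappa ^ 2 + 2 * c.B0 ηh ^ 2 * c.Lw ^ 2)) ^ 2
      ≤ c.B0 ηh ^ 2 := by gcongr
  rw [mul_pow, Real.sq_sqrt hq.le] at h4
  have hM := Mom_pos (c := c) (one_div_pos.2 hB) η
  have h5 : c.Mom (1 / c.B0 ηh) η ≤ 2 * c.B0 ηh := by
    have e : c.Mom (1 / c.B0 ηh) η = c.B0 ηh
        + η ^ 2 * (c.Lu ^ 2 * c.kappa ^ 2 + 2 * c.B0 ηh ^ 2 * c.Lw ^ 2) / c.B0 ηh := by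
      unfold Consts.Mom
      field_simp
    rw [e]
    have : η ^ 2 * (c.Lu ^ 2 * c.kappa ^ 2 + 2 * c.B0 ηh ^ 2 * c.Lw ^ 2) / c.B0 ηh
        ≤ c.B0 ηh := by
      rw [div_le_iff₀ hB]
      linarith
    linarith
  unfold Consts.numSteps
  rw [Nat.ceil_eq_iff one_ne_zero]
  constructor
  · simpa using div_pos hM (by positivity)
  · rw [Nat.cast_one, div_le_one (by positivity)]
    exact h5

/-- From `L_u κ η ≤ B₀/2` and `L_w η ≤ 1/4`, the quantity to be bounded by `B₀²` is at most `3
B₀²/8`. -/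
theorem StepSize.oneStepSize (hc : c.Valid) {ηh : ℝ} (h0 : 0 < ηh) {η : ℝ}
    (hη : c.StepSize (1 / c.B0 ηh) η) : c.OneStepSize ηh η := by
  have hB := B0_pos hc h0
  obtain ⟨hη0, -, hLP, hωk⟩ := StepSize.spec hc (one_div_pos.2 hB) hη
  have hLw := hc.Lw_pos
  have hLu := hc.Lu_pos
  have hk := kappa_pos hc
  refine ⟨hη0, le_min (hη.2.trans (min_le_left _ _)) ?_⟩
  have hq : 0 < c.Lu ^ 2 * c.kappa ^ 2 + 2 * c.B0 ηh ^ 2 * c.Lw ^ 2 := by positivity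
  rw [le_div_iff₀ (Real.sqrt_pos.2 hq)]
  refine abs_le_of_sq_le_sq' ?_ hB.le |>.2
  rw [mul_pow, Real.sq_sqrt hq.le]
  have h1 : c.Lu * c.kappa * η ≤ c.B0 ηh / 2 := by
    rw [one_div, inv_mul_le_iff₀ hB] at hωk
    linarith
  have h2 : c.Lw * η ≤ 1 / 4 := by
    refine le_trans ?_ hLP
    have : 0 ≤ c.kappa * (c.Lw * η) := by positivity
    unfold Consts.LPhi
    linarith
  have h3 : (c.Lu * c.kappa * η) ^ 2 ≤ (c.B0 ηh / 2) ^ 2 := by gcongr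
  have h4 : (c.Lw * η) ^ 2 ≤ (1 / 4) ^ 2 := by gcongr
  have h5 : c.B0 ηh ^ 2 * (c.Lw * η) ^ 2 ≤ c.B0 ηh ^ 2 * (1 / 4) ^ 2 := by gcongr
  have h6 := sq_nonneg (c.B0 ηh)
  nlinarith

theorem exists_stepSize_bound (hc : c.Valid) {ω s C : ℝ} (hω : 0 < ω) (hs : 0 < s) (hC : 0 < C) :
    ∃ ε₀ : ℝ, 0 < ε₀ ∧ ∀ ε : ℝ, 0 < ε → ε ≤ ε₀ → c.StepSize ω (s * ε / (4 * Real.sqrt C)) := by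
  have hk := kappa_pos hc
  have hLu := hc.Lu_pos
  have hC0 := Real.sqrt_pos.2 (C0_pos hc)
  have hLP := LPhi_pos hc
  have hsC := Real.sqrt_pos.2 hC
  set m := min (min (1 / (2 * Real.sqrt c.C0)) (1 / (4 * c.LPhi)))
    (1 / (2 * ω * c.Lu * c.kappa)) with hm
  have hm0 : 0 < m := lt_min (lt_min (by positivity) (by positivity)) (by positivity)
  refine ⟨m * (4 * Real.sqrt C) / s, by positivity, fun ε hε hle => ⟨by positivity, ?_⟩⟩
  rw [le_div_iff₀ hs] at hle
  rw [← hm, div_le_iff₀ (by positivity)]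
  linarith

/-- `M_ω` increases with `η`, and `η ≤ 1/(4 L_{Φ₀})`; this makes `S` bounded uniformly in `ε` and
`n`. -/
theorem numSteps_le (hc : c.Valid) {ηh : ℝ} (h0 : 0 < ηh) {ω η : ℝ} (hω : 0 < ω)
    (hη : c.StepSize ω η) :
    (c.numSteps ω η ηh : ℝ) ≤ c.Mom ω (1 / (4 * c.LPhi)) / (2 * c.B0 ηh) + 1 := by
  have hB := B0_pos hc h0
  have hM := Mom_pos (c := c) hω η
  have h1 := (Nat.ceil_lt_add_one (a := c.Mom ω η / (2 * c.B0 ηh)) (by positivity)).le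
  refine h1.trans ?_
  have h2 : η ≤ 1 / (4 * c.LPhi) := (hη.2.trans (min_le_left _ _)).trans (min_le_right _ _)
  have hη0 := hη.1
  unfold Consts.Mom
  gcongr

end Numeric

/-! ### Oracle counts and the accuracy guarantee. -/

section Complexity

variable {n p q : ℕ} {P : Problem n p q} {c : Consts}

theorem run_counts (hc : c.Valid) (hn : 0 < n) (hA : Assumptions P c) {ηh : ℝ}
    (h0 : 0 < ηh) (h1 : ηh ≤ 2 / (c.Lu + c.muH)) (η : ℝ) (S : ℕ) (π : ℕ → Equiv.Perm (Fin n))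
    (w₀ : Euc p) (u₀ : Euc q) (T : ℕ) :
    (P.run η ηh S π w₀ u₀ T).evalW = T * n ∧ (P.run η ηh S π w₀ u₀ T).evalU = T * S * n ∧
    (P.run η ηh S π w₀ u₀ T).evalProxF = T ∧ (P.run η ηh S π w₀ u₀ T).evalProxH = T * S := by
  induction T with
  | zero => simp [Problem.run]
  | succ T ih =>
    obtain ⟨-, -, e1, e2, e3, e4⟩ :=
      epoch_spec hc hn hA h0 h1 η S (π T) (P.run η ηh S π w₀ u₀ T)
    obtain ⟨i1, i2, i3, i4⟩ := ih
    simp only [Problem.run]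
    rw [e1, e2, e3, e4, i1, i2, i3, i4]
    refine ⟨?_, ?_, ?_, ?_⟩ <;> ring

theorem Tbar_nonneg (hc : c.Valid) (hn : 0 < n) (hA : Assumptions P c) {ω s C ε : ℝ}
    (hω : 0 < ω) (hs : 0 < s) (hs1 : s < 1) (hε : 0 < ε) {w₀ : Euc p} (hw₀ : w₀ ∈ effDom P.f)
    (u₀ : Euc q) : 0 ≤ Tbar P c ω s C ε w₀ u₀ := by
  have hg := gap_nonneg hc hn hA hw₀
  have h1 : 0 < 1 - s ^ 2 := by nlinarith
  unfold Tbar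
  positivity

/-- The `ε⁻²` term is absorbed into `ε⁻³` by `ε ≤ εm`. Absolute values keep the constant nonnegative
for arbitrary `Δ` and `R`, which are fixed before the problem. -/
theorem Tbar_le {ω s C ε εm Δ R : ℝ} (hω : 0 < ω) (hs : 0 < s) (hs1 : s < 1) (hε : 0 < ε)
    (hεm : ε ≤ εm) {w₀ : Euc p} {u₀ : Euc q} (hΔ : P.gap w₀ ≤ Δ)
    (hR : ‖u₀ - P.uStar w₀‖ ^ 2 ≤ R) :
    Tbar P c ω s C ε w₀ u₀ ≤ (32 * Real.sqrt C * |Δ| / (s * (1 - s ^ 2))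
      + 4 * ω * c.Lu ^ 2 * |R| * εm / (1 - s ^ 2)) / ε ^ 3 := by
  have h1 : 0 < 1 - s ^ 2 := by nlinarith
  unfold Tbar
  rw [add_div, div_div, div_div]
  refine add_le_add ?_ ?_
  · have := hΔ.trans (le_abs_self Δ)
    gcongr
  · calc 4 * ω * c.Lu ^ 2 * ‖u₀ - P.uStar w₀‖ ^ 2 / ((1 - s ^ 2) * ε ^ 2)
        = 4 * ω * c.Lu ^ 2 * ‖u₀ - P.uStar w₀‖ ^ 2 * ε / ((1 - s ^ 2) * ε ^ 3) := by
          field_simp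
      _ ≤ _ := by
          have := hR.trans (le_abs_self R)
          gcongr

theorem avgGradMap_le_sq (hc : c.Valid) (hn : 0 < n) (hA : Assumptions P c) {ηh : ℝ}
    (h0 : 0 < ηh) (h1 : ηh ≤ 2 / (c.Lu + c.muH)) {ω s C ε η : ℝ} (hω : 0 < ω) (hs : 0 < s)
    (hs1 : s < 1) (hC : 0 < C) (hCw : c.Cw ≤ C) (hε : 0 < ε)
    (hηε : η = s * ε / (4 * Real.sqrt C)) (hη : c.StepSize ω η) (hG : GradMapBound P c η)
    {w₀ : Euc p} (hw₀ : w₀ ∈ effDom P.f) (u₀ : Euc q) (π : ℕ → Equiv.Perm (Fin n)) {T : ℕ}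
    (hT : ⌊Tbar P c ω s C ε w₀ u₀⌋₊ ≤ T) :
    P.avgGradMap η (fun t => (P.run η ηh (c.numSteps ω η ηh) π w₀ u₀ t).w) T ≤ ε ^ 2 := by
  refine (avgGradMap_le hc hn hA h0 h1 hω hη hG hw₀ u₀ π T).trans ?_
  have hs2 : 0 < 1 - s ^ 2 := by nlinarith
  have hsC := Real.sqrt_pos.2 hC
  have hη0 := hη.1
  -- The average has `T + 1` terms, so the floor of `T̄` suffices.
  have hTb : Tbar P c ω s C ε w₀ u₀ ≤ (T : ℝ) + 1 := by
    have h2 := (Nat.lt_floor_add_one (Tbar P c ω s C ε w₀ u₀)).le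
    have h3 : ((⌊Tbar P c ω s C ε w₀ u₀⌋₊ : ℕ) : ℝ) ≤ T := by exact_mod_cast hT
    linarith
  have hT1 : (0 : ℝ) < (T : ℝ) + 1 := by positivity
  -- The target splits as `(1 - s²) ε² + s² ε²`; `T̄` is defined so that the first share matches the
  -- initial error exactly.
  have hfirst : 4 * (2 * P.gap w₀ + ω * c.Lu ^ 2 * η * ‖u₀ - P.uStar w₀‖ ^ 2)
      / (η * ((T : ℝ) + 1)) ≤ (1 - s ^ 2) * ε ^ 2 := by
    rw [← div_div, div_le_iff₀ hT1]
    have e : 4 * (2 * P.gap w₀ + ω * c.Lu ^ 2 * η * ‖u₀ - P.uStar w₀‖ ^ 2) / η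
        = (1 - s ^ 2) * ε ^ 2 * Tbar P c ω s C ε w₀ u₀ := by
      rw [hηε]
      unfold Tbar
      field_simp
      ring
    rw [e]
    gcongr
  -- Since `C η² = s² ε²/16`, the variance term uses at most half of the second share.
  have hsecond : 8 * c.Cw * η ^ 2 ≤ s ^ 2 * ε ^ 2 := by
    have e : C * η ^ 2 = s ^ 2 * ε ^ 2 / 16 := by
      rw [hηε, div_pow, mul_pow, mul_pow, Real.sq_sqrt hC.le]
      field_simp
      norm_num
    have h2 : c.Cw * η ^ 2 ≤ C * η ^ 2 := by gcongr
    have h3 : 0 ≤ s ^ 2 * ε ^ 2 := by positivity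
    linarith
  linarith

theorem sq_le_of_avg_le {a : ℕ → ℝ} {T : ℕ} {b : ℝ}
    (h : 1 / ((T : ℝ) + 1) * ∑ t ∈ Finset.range (T + 1), a t ^ 2 ≤ b) {t' : ℕ} (ha : 0 ≤ a t')
    (hmin : ∀ t ≤ T, a t' ≤ a t) : a t' ^ 2 ≤ b := by
  refine le_trans ?_ h
  have hT1 : (0 : ℝ) < (T : ℝ) + 1 := by positivity
  rw [one_div, ← div_eq_inv_mul, le_div_iff₀ hT1]
  have : ∑ _t ∈ Finset.range (T + 1), a t' ^ 2 ≤ ∑ t ∈ Finset.range (T + 1), a t ^ 2 := by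
    refine Finset.sum_le_sum fun t ht => ?_
    have := hmin t (Nat.lt_succ_iff.1 (Finset.mem_range.1 ht))
    gcongr
  simp only [Finset.sum_const, Finset.card_range, nsmul_eq_mul] at this
  push_cast at this
  linarith

theorem integral_uniform_eq (T : ℕ) (a : ℕ → ℝ) :
    ∫ t : Fin (T + 1), a t ∂(PMF.uniformOfFintype (Fin (T + 1))).toMeasure
      = 1 / ((T : ℝ) + 1) * ∑ t ∈ Finset.range (T + 1), a t := by
  rw [PMF.integral_eq_sum, Finset.sum_range, Finset.mul_sum]
  refine Finset.sum_congr rfl fun i _ => ?_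
  have e : ((T : ENNReal) + 1).toReal = (T : ℝ) + 1 := by
    exact_mod_cast ENNReal.toReal_natCast (T + 1)
  simp [ENNReal.toReal_inv, e]

end Complexity

end ShufflingMinimax

end

/-! ### Assembly of the theorem. -/

open ShufflingMinimax in
theorem mainTheorem3 (c : Consts) (hc : c.Valid)
    (ηh : ℝ) (hηh : 0 < ηh) (hηh' : ηh ≤ 2 / (c.Lu + c.muH)) :
    -- the lower level problem is uniquely solvable and `Φ₀` is differentiable
    (∀ (n p q : ℕ) (P : Problem n p q), 0 < n → Assumptions P c →
      (∀ w u, (∀ v, P.h u - ((P.Hbar w u : ℝ) : EReal) ≤ P.h v - ((P.Hbar w v : ℝ) : EReal)) ↔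
        u = P.uStar w) ∧
      Differentiable ℝ (fun w => (P.Phi w).toReal)) ∧
    -- the convergence estimate
    (∀ (n p q : ℕ) (P : Problem n p q), 0 < n → Assumptions P c →
      ∀ (ω η : ℝ), 0 < ω → c.StepSize ω η → GradMapBound P c η →
      ∀ w₀ ∈ effDom P.f, ∀ u₀ ∈ effDom P.h, ∀ (π : ℕ → Equiv.Perm (Fin n)) (T : ℕ),
        P.avgGradMap η (fun t => (P.run η ηh (c.numSteps ω η ηh) π w₀ u₀ t).w) T
          ≤ 4 * (2 * P.gap w₀ + ω * c.Lu ^ 2 * η * ‖u₀ - P.uStar w₀‖ ^ 2) / (η * ((T : ℝ) + 1))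
            + 8 * c.Cw * η ^ 2) ∧
    -- one ascent step per epoch
    (0 < c.B0 ηh ∧
      (∀ η : ℝ, c.OneStepSize ηh η → c.numSteps (1 / c.B0 ηh) η ηh = 1) ∧
      (∀ η : ℝ, c.StepSize (1 / c.B0 ηh) η → c.OneStepSize ηh η)) ∧
    -- accuracy `ε` and oracle complexity
    (∀ (ω s C Δ R : ℝ), 0 < ω → 0 < s → s < 1 → 0 < C → c.Cw ≤ C →
      ∃ K ε₀ : ℝ, 0 < K ∧ 0 < ε₀ ∧
        (∀ ε : ℝ, 0 < ε → ε ≤ ε₀ → c.StepSize ω (s * ε / (4 * Real.sqrt C))) ∧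
        ∀ ε : ℝ, 0 < ε → ∀ η : ℝ, η = s * ε / (4 * Real.sqrt C) → c.StepSize ω η →
        ∀ S : ℕ, S = c.numSteps ω η ηh →
        (S : ℝ) ≤ K ∧
        ∀ (n p q : ℕ) (P : Problem n p q), 0 < n → Assumptions P c → GradMapBound P c η →
        ∀ w₀ ∈ effDom P.f, ∀ u₀ ∈ effDom P.h,
        P.gap w₀ ≤ Δ → ‖u₀ - P.uStar w₀‖ ^ 2 ≤ R →
        ∀ π : ℕ → Equiv.Perm (Fin n),
          (∀ T : ℕ, ⌊Tbar P c ω s C ε w₀ u₀⌋₊ ≤ T →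
            P.avgGradMap η (fun t => (P.run η ηh S π w₀ u₀ t).w) T ≤ ε ^ 2 ∧
            (∀ t' ≤ T,
              (∀ t ≤ T, ‖P.gradMap η (P.run η ηh S π w₀ u₀ t').w‖
                ≤ ‖P.gradMap η (P.run η ηh S π w₀ u₀ t).w‖) →
              ‖P.gradMap η (P.run η ηh S π w₀ u₀ t').w‖ ^ 2 ≤ ε ^ 2) ∧
            ∫ t : Fin (T + 1), ‖P.gradMap η (P.run η ηh S π w₀ u₀ t).w‖ ^ 2
              ∂(PMF.uniformOfFintype (Fin (T + 1))).toMeasure ≤ ε ^ 2) ∧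
          ∀ T : ℕ, T = ⌊Tbar P c ω s C ε w₀ u₀⌋₊ →
            (T : ℝ) ≤ K / ε ^ 3 ∧
            ((P.run η ηh S π w₀ u₀ T).evalW : ℝ) ≤ K * n / ε ^ 3 ∧
            ((P.run η ηh S π w₀ u₀ T).evalU : ℝ) ≤ K * n / ε ^ 3 ∧
            ((P.run η ηh S π w₀ u₀ T).evalProxF : ℝ) ≤ K / ε ^ 3 ∧
            ((P.run η ηh S π w₀ u₀ T).evalProxH : ℝ) ≤ K / ε ^ 3) := by
  refine ⟨fun n p q P hn hA => ⟨fun w u => ?_, fun w => ?_⟩, ?_, ⟨?_, ?_, ?_⟩, ?_⟩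
  · exact (uStar_spec hc hn hA w).2 u
  · exact (hasGradientAt_Phi hc hn hA w).differentiableAt
  · intro n p q P hn hA ω η hω hη hG w₀ hw₀ u₀ _ π T
    exact avgGradMap_le hc hn hA hηh hηh' hω hη hG hw₀ u₀ π T
  · exact B0_pos hc hηh
  · exact fun η hη => numSteps_one hc hηh hη
  · exact fun η hη => StepSize.oneStepSize hc hηh hη
  · intro ω s C Δ R hω hs hs1 hC hCw
    obtain ⟨ε₀, hε₀, hsmall⟩ := exists_stepSize_bound (c := c) hc hω hs hC
    have hLP := LPhi_pos hc
    have hsC := Real.sqrt_pos.2 hC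
    have hs2 : 0 < 1 - s ^ 2 := by nlinarith
    have hB := B0_pos hc hηh
    -- The largest `ε` compatible with `η ≤ 1/(4 L_{Φ₀})`.
    set εm := Real.sqrt C / (s * c.LPhi) with hεm
    have hεm0 : 0 < εm := by positivity
    set K₁ := 32 * Real.sqrt C * |Δ| / (s * (1 - s ^ 2))
      + 4 * ω * c.Lu ^ 2 * |R| * εm / (1 - s ^ 2) with hK₁
    set K₂ := c.Mom ω (1 / (4 * c.LPhi)) / (2 * c.B0 ηh) + 1 with hK₂
    have hK₁0 : 0 ≤ K₁ := by positivity
    have hK₂0 : 0 < K₂ := by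
      have := Mom_pos (c := c) hω (1 / (4 * c.LPhi))
      positivity
    have hK₁₂ : 0 ≤ K₁ * K₂ := by positivity
    -- `K₁` controls the number of epochs times `ε³`, `K₂` controls `S`, and the product controls
    -- the ascent work; the sum dominates all three.
    refine ⟨K₁ + K₂ + K₁ * K₂, ε₀, by positivity, hε₀, hsmall, ?_⟩
    intro ε hε η hηε hη S hS
    have hSK : (S : ℝ) ≤ K₂ := by rw [hS]; exact numSteps_le hc hηh hω hη
    refine ⟨by linarith, ?_⟩
    intro n p q P hn hA hG w₀ hw₀ u₀ _ hΔ hR π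
    subst hS
    refine ⟨fun T hT => ?_, fun T hT => ?_⟩
    · have havg := avgGradMap_le_sq hc hn hA hηh hηh' hω hs hs1 hC hCw hε hηε hη hG hw₀ u₀ π hT
      refine ⟨havg, fun t' _ hmin => ?_, ?_⟩
      · exact sq_le_of_avg_le
          (a := fun t => ‖P.gradMap η (P.run η ηh (c.numSteps ω η ηh) π w₀ u₀ t).w‖) havg
          (norm_nonneg _) hmin
      · exact (integral_uniform_eq T
          (fun t => ‖P.gradMap η (P.run η ηh (c.numSteps ω η ηh) π w₀ u₀ t).w‖ ^ 2)).trans_le havg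
    · have hεle : ε ≤ εm := by
        have h2 : η ≤ 1 / (4 * c.LPhi) :=
          (hη.2.trans (min_le_left _ _)).trans (min_le_right _ _)
        rw [hηε, div_le_div_iff₀ (by positivity) (by positivity)] at h2
        rw [hεm, le_div_iff₀ (by positivity)]
        linarith
      have hTK : (T : ℝ) ≤ K₁ / ε ^ 3 := by
        rw [hT]
        refine (Nat.floor_le (Tbar_nonneg hc hn hA hω hs hs1 hε hw₀ u₀)).trans ?_
        exact Tbar_le hω hs hs1 hε hεle hΔ hR
      obtain ⟨e1, e2, e3, e4⟩ :=
        run_counts hc hn hA hηh hηh' η (c.numSteps ω η ηh) π w₀ u₀ T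
      rw [e1, e2, e3, e4]
      push_cast
      have hTS : (T : ℝ) * c.numSteps ω η ηh ≤ K₁ * K₂ / ε ^ 3 := by
        calc (T : ℝ) * c.numSteps ω η ηh ≤ K₁ / ε ^ 3 * K₂ := by gcongr
          _ = _ := by ring
      have hK1 : K₁ / ε ^ 3 ≤ (K₁ + K₂ + K₁ * K₂) / ε ^ 3 := by gcongr; linarith
      have hK2 : K₁ * K₂ / ε ^ 3 ≤ (K₁ + K₂ + K₁ * K₂) / ε ^ 3 := by gcongr; linarith
      have hT1 := hTK.trans hK1
      have hT2 := hTS.trans hK2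
      refine ⟨hT1, ?_, ?_, hT1, hT2⟩
      · rw [mul_div_right_comm]; gcongr
      · rw [mul_div_right_comm]; gcongr
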